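/- Let $r>0$, $n\in\mathbb N$, $\mathcal C=C([-r,0];\mathbb R^n)$ with the sup norm, and let $\mu:[-r,0]\to\mathbb R^{n\times n}$ be of bounded variation, continuous from the left on $(-r,0)$, with $\mu(0)=0$. Put $$L_0\eta=\int_{[-r,0]}d\mu(\theta)\,\eta(\theta)\quad(\eta\in\mathcal C),\qquad \Delta(\lambda)=\lambda I-\int_{[-r,0]}d\mu(\theta)\,e^{\lambda\theta}\quad(\lambda\in\mathbb C),$$ and assume that $\det\Delta(\lambda)=0$ has $\lambda=0$ as a simple root and that all its other complex roots have negative real part. For $\psi\in C([0,r];\mathbb R^{n*})$ and $\eta\in\mathcal C$ let $$\langle\psi,\eta\rangle=\psi(0)\eta(0)-\int_{[-r,0]}\int_0^\theta\psi(s-\theta)\,d\mu(\theta)\,\eta(s)\,ds .$$ Let $d\in\mathbb R^n$ and $d_2\in\mathbb R^{n*}$ satisfy $\Delta(0)d=0$ and $d_2\Delta(0)=0$, let $\Phi\in\mathcal C$ be the constant function $d$ and $\Psi\in C([0,r];\mathbb R^{n*})$ the constant function $c\,d_2$, where the real number $c$ is such that $\langle\Psi,\Phi\rangle=1$, and put $\hat\Psi=\Psi(0)=c\,d_2$.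 Let $G,F:\mathcal C\to\mathbb R^n$ be bounded and differentiable with bounded derivatives, let $(\xi_t)_{t\ge0}$ be a stochastic process, and let $\sigma$ be a bounded real function on its state space. (Markov noise $\xi$ with mean-zero $\sigma$ is a special case; these two properties are not needed.) Then for all $T>0$ and $R\ge0$ there is a constant $C>0$ such that the following holds for every $\varepsilon>0$, every sample point for which $t\mapsto\sigma(\xi_t)$ is measurable, and every $\eta\in\mathcal C$ with $\|\eta\|\le R$. Let $x\in C([-r,\infty);\mathbb R^n)$ be a solution, in integrated form, of $$\dot x(t)=L_0(\Pi_tx)+\varepsilon G(\Pi_tx)+\varepsilon F(\Pi_tx)\,\sigma(\xi_t)\quad(t\ge0),\qquad \Pi_0x=\eta,$$ where $(\Pi_tx)(\theta)=x(t+\theta)$ for $\theta\in[-r,0]$, put $z_t=\langle\Psi,\Pi_tx\rangle$, and let the continuous scalar path $\mathfrak z$ be a solution, in integrated form, of $$\dot{\mathfrak z}_t=\varepsilon\hat\Psi G(\Phi\mathfrak z_t)+\varepsilon\hat\Psi F(\Phi\mathfrak z_t)\,\sigma(\xi_t)\quad(t\ge0),\qquad \mathfrak z_0=z_0 .$$ Then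 $$|z_t-\mathfrak z_t|\le C\varepsilon\qquad\text{for all } t\in[0,T/\varepsilon].$$ In particular $C$ depends neither on $\varepsilon$, nor on $t$, nor on the sample path, and on the initial segment only through the bound $R$. -/

import Mathlib

open MeasureTheory Set
open scoped Matrix NNReal

noncomputable section

namespace DelayEq

instance compactIccSpace_Icc (a b : ℝ) : CompactIccSpace (Icc a b) :=
  ⟨fun {_ _} => isClosed_Icc.isCompact⟩

/-- The phase space of segments: continuous maps from `[-r, 0]` to `ℝⁿ`, with the sup norm
(of the Euclidean norm on `ℝⁿ`). -/
abbrev Segment (n : ℕ) (r : ℝ) : Type := C(Icc (-r) 0, EuclideanSpace ℝ (Fin n))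

/-- The dual space of segments: continuous maps from `[0, r]` to row vectors. -/
abbrev RowSegment (n : ℕ) (r : ℝ) : Type := C(Icc 0 r, Fin n → ℝ)

/-- A matrix-valued function `μ` on `[-r, 0]`, `r > 0`, of bounded variation, continuous from the
left on `(-r, 0)` and normalized by `μ(0) = 0`. -/
structure Kernel (n : ℕ) (r : ℝ) where
  pos : 0 < r
  toFun : Icc (-r) 0 → Matrix (Fin n) (Fin n) ℝ
  boundedVariation : ∀ i j, BoundedVariationOn (fun θ => toFun θ i j) univ
  leftContinuous : ∀ θ : Icc (-r) 0, -r < (θ : ℝ) → (θ : ℝ) < 0 →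
    ContinuousWithinAt toFun (Iic θ) θ
  normalized : ∀ θ : Icc (-r) 0, (θ : ℝ) = 0 → toFun θ = 0

namespace Kernel

variable {n : ℕ} {r : ℝ} (μ : Kernel n r)

/-- The Stieltjes integral `∫_{[-r,0]} f(θ) dμᵢⱼ(θ)`. -/
def stieltjes {E : Type*} [NormedAddCommGroup E] [NormedSpace ℝ E]
    (i j : Fin n) (f : Icc (-r) 0 → E) : E :=
  (μ.boundedVariation i j).vectorMeasure.integral f (ContinuousLinearMap.lsmul ℝ ℝ).flip

/-- `L₀ η = ∫_{[-r,0]} dμ(θ) η(θ)`. -/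
def L₀ (η : Segment n r) : EuclideanSpace ℝ (Fin n) :=
  WithLp.toLp 2 fun i => ∑ j, μ.stieltjes i j fun θ => η θ j

/-- `Δ(z) = z I - ∫_{[-r,0]} dμ(θ) e^{z θ}`. -/
def charMatrix (z : ℂ) : Matrix (Fin n) (Fin n) ℂ :=
  z • (1 : Matrix (Fin n) (Fin n) ℂ) -
    Matrix.of fun i j => μ.stieltjes i j fun θ => Complex.exp (z * ((θ : ℝ) : ℂ))

/-- The characteristic equation `det Δ(z) = 0` has `0` as a simple root, and all its other complex
roots have negative real part. -/
def IsOnVergeOfInstability : Prop :=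
  (μ.charMatrix 0).det = 0 ∧ deriv (fun z => (μ.charMatrix z).det) 0 ≠ 0 ∧
    ∀ z : ℂ, (μ.charMatrix z).det = 0 → z ≠ 0 → z.re < 0

/-- The bilinear form
`⟨ψ, η⟩ = ψ(0) η(0) - ∫_{[-r,0]} ∫_0^θ ψ(s - θ) dμ(θ) η(s) ds`.
For `θ ∈ [-r, 0]` and `s` between `θ` and `0` one has `s - θ ∈ [0, r]` and `s ∈ [-r, 0]`, so that
the projections onto these intervals act there as the identity. -/
def pairing (ψ : RowSegment n r) (η : Segment n r) : ℝ :=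
  (∑ i, ψ (projIcc 0 r μ.pos.le 0) i * η (projIcc (-r) 0 (neg_nonpos.2 μ.pos.le) 0) i) -
    ∑ i, ∑ j, μ.stieltjes i j fun θ =>
      ∫ s in (0 : ℝ)..(θ : ℝ), ψ (projIcc 0 r μ.pos.le (s - θ)) i *
        η (projIcc (-r) 0 (neg_nonpos.2 μ.pos.le) s) j

end Kernel

variable {n : ℕ} {r : ℝ}

/-- The segment extractor `(Π_t x)(θ) = x(t + θ)`, for `x` continuous on `[-r, ∞)` and `t ≥ 0`
(then `t + θ ≥ -r`, and the projection onto `[-r, ∞)` acts as the identity). -/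
def segment (x : C(Ici (-r), EuclideanSpace ℝ (Fin n))) (t : ℝ) : Segment n r :=
  ⟨fun θ => x (projIci (-r) (t + θ)), by
    refine x.continuous.comp (Continuous.subtype_mk ?_ _)
    fun_prop⟩

/-- A vector field on segments that is bounded, differentiable, and has a bounded derivative. -/
def BoundedWithBoundedDeriv (G : Segment n r → EuclideanSpace ℝ (Fin n)) : Prop :=
  (∃ M : ℝ, ∀ η, ‖G η‖ ≤ M) ∧ Differentiable ℝ G ∧ ∃ M : ℝ, ∀ η, ‖fderiv ℝ G η‖ ≤ M

/-- `x` solves `x'(t) = L₀(Π_t x) + ε G(Π_t x) + ε F(Π_t x) u(t)`, `t ≥ 0`, in integrated form,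
with initial segment `Π₀ x = η`; `u` is the (merely measurable) path of the driving noise. -/
def IsSolution (μ : Kernel n r) (G F : Segment n r → EuclideanSpace ℝ (Fin n)) (ε : ℝ)
    (u : ℝ → ℝ) (η : Segment n r) (x : C(Ici (-r), EuclideanSpace ℝ (Fin n))) : Prop :=
  segment x 0 = η ∧ ∀ t : ℝ, 0 ≤ t →
    x (projIci (-r) t) = x (projIci (-r) 0) +
      ∫ s in (0 : ℝ)..t,
        (μ.L₀ (segment x s) + ε • G (segment x s) + (ε * u s) • F (segment x s))

/-- The continuous path `w` solves the scalar equation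
`w'(t) = ε Ψ̂ G(Φ w(t)) + ε Ψ̂ F(Φ w(t)) u(t)`, `t ≥ 0`, in integrated form, with `w(0) = w₀`. -/
def IsReducedSolution (Ψhat : Fin n → ℝ) (Φ : Segment n r)
    (G F : Segment n r → EuclideanSpace ℝ (Fin n)) (ε : ℝ)
    (u : ℝ → ℝ) (w₀ : ℝ) (w : ℝ → ℝ) : Prop :=
  ContinuousOn w (Ici 0) ∧ ∀ t : ℝ, 0 ≤ t →
    w t = w₀ + ∫ s in (0 : ℝ)..t,
      (ε * (∑ i, Ψhat i * G (w s • Φ) i) + ε * (∑ i, Ψhat i * F (w s • Φ) i) * u s)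

end DelayEq

end

/-! The constant segment `d` is the critical mode of the linear equation, and the pairing with the
left null vector is its coordinate. For a constant row `l` with `l Δ(0) = 0` the pairing is `l (η 0)
- l (L (∫_0^· η))`. Along `x' = L (history x) + f` the contributions of `L` to its two terms cancel
(`SolvesOn.pairingCLM_history`), so the coordinate moves by `∫ l f` alone. Thus `z` solves the
reduced equation exactly, except that `G` and `F` are evaluated at `Π_t x` instead of `z_t Φ`.

If `‖Π_t x - z_t Φ‖ ≤ A (e^{-κt} R + Mε)`, the mismatch of the right-hand sides is at most a
constant times `ε` times this. Its integral over `[0, T/ε]` is `O(ε)`: the transient is integrable,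
and the rest is of order `ε²` on a time of order `1/ε`. Gronwall at rate `O(ε)` costs a bounded
factor (`abs_sub_le_of_integral_eq`). The noise is never averaged: the same path drives both
equations.

The substance is the transversal decay, `exists_norm_stableProj_history_le`. The time-`r` solution
operator, followed by the projection that kills `d`, is compact. An eigenvalue `m` with `|m| ≥ 1`
would give a Floquet solution `x`. For each `z` with `e^{zr} = m`, the integral of `e^{-zs} x(s)`
over a period solves the characteristic equation at `z` (`SolvesOn.smul_integral_eq`), where `Re z ≥
0`. It vanishes for `z ≠ 0` by the hypothesis on the roots. For `z = 0` it vanishes because `ker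
Δ(0)` is spanned by `d` (simplicity of the root) and the pairing of `x` is zero. These integrals are
all the Fourier coefficients of one function, so `x = 0`. Hence the spectral radius is below one and
the powers decay geometrically. -/

noncomputable section

namespace DelayEq

/-! ### Segments of a path and their primitives -/

section History

variable {V : Type*} [NormedAddCommGroup V] {r : ℝ}

/-- The segment `θ ↦ x (s + θ)` on `[-r, 0]` of a path `x` on the whole line. -/
def history (r : ℝ) (x : C(ℝ, V)) (s : ℝ) : C(Icc (-r) 0, V) :=
  x.comp ⟨fun θ => s + θ, by fun_prop⟩

@[simp] lemma history_apply (x : C(ℝ, V)) (s : ℝ) (θ : Icc (-r) 0) :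
    history r x s θ = x (s + θ) := rfl

lemma continuous_history (x : C(ℝ, V)) : Continuous (history r x) :=
  (ContinuousMap.curry (⟨fun p : ℝ × Icc (-r) 0 => x (p.1 + p.2), by fun_prop⟩ :
    C(ℝ × Icc (-r) 0, V))).continuous

lemma intervalIntegrable_projIcc (hr : 0 ≤ r) (η : C(Icc (-r) 0, V)) (a b : ℝ) :
    IntervalIntegrable (fun s => η (projIcc (-r) 0 (neg_nonpos.2 hr) s)) volume a b :=
  (η.continuous.comp continuous_projIcc).intervalIntegrable a b

variable [NormedSpace ℂ V]

/-- `θ ↦ ∫_0^θ η` as a segment. -/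
def primitiveSegment (hr : 0 ≤ r) (η : C(Icc (-r) 0, V)) : C(Icc (-r) 0, V) :=
  ⟨fun θ => ∫ s in (0 : ℝ)..θ, η (projIcc (-r) 0 (neg_nonpos.2 hr) s), by
    exact (intervalIntegral.continuous_primitive (intervalIntegrable_projIcc hr η) 0).comp
      continuous_subtype_val⟩

/-- Integration from `0` as a bounded operator on segments. -/
def primitiveCLM (V : Type*) [NormedAddCommGroup V] [NormedSpace ℂ V] (hr : 0 ≤ r) :
    C(Icc (-r) 0, V) →L[ℂ] C(Icc (-r) 0, V) :=
  LinearMap.mkContinuous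
    { toFun := primitiveSegment hr
      map_add' := fun η ζ => by
        ext θ
        simp only [primitiveSegment, ContinuousMap.coe_mk, ContinuousMap.add_apply]
        exact intervalIntegral.integral_add (intervalIntegrable_projIcc hr η _ _)
          (intervalIntegrable_projIcc hr ζ _ _)
      map_smul' := fun c η => by
        ext θ
        simp [primitiveSegment] } r fun η => by
    refine (ContinuousMap.norm_le _ (by positivity)).2 fun θ => ?_
    have h := intervalIntegral.norm_integral_le_of_norm_le_const (a := 0) (b := (θ : ℝ))
      (f := fun s => η (projIcc (-r) 0 (neg_nonpos.2 hr) s)) (C := ‖η‖)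
      fun s _ => η.norm_coe_le_norm _
    refine h.trans ?_
    rw [mul_comm]
    gcongr
    rw [sub_zero, abs_of_nonpos θ.2.2]
    linarith [θ.2.1]

lemma primitiveCLM_apply (hr : 0 ≤ r) (η : C(Icc (-r) 0, V)) (θ : Icc (-r) 0) :
    primitiveCLM V hr η θ = ∫ s in (0 : ℝ)..θ, η (projIcc (-r) 0 (neg_nonpos.2 hr) s) := rfl

lemma primitiveCLM_history (hr : 0 ≤ r) (x : C(ℝ, V)) (t : ℝ) (θ : Icc (-r) 0) :
    primitiveCLM V hr (history r x t) θ = ∫ s in t..(t + θ), x s := by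
  rw [primitiveCLM_apply]
  have h : ∀ s ∈ uIcc (0 : ℝ) θ,
      history r x t (projIcc (-r) 0 (neg_nonpos.2 hr) s) = x (t + s) := fun s hs => by
    rw [uIcc_of_ge θ.2.2] at hs
    rw [history_apply, projIcc_of_mem _ ⟨θ.2.1.trans hs.1, hs.2⟩]
  rw [intervalIntegral.integral_congr h, intervalIntegral.integral_comp_add_left, add_zero]

variable [CompleteSpace V]

lemma intervalIntegral_segment_apply {f : ℝ → C(Icc (-r) 0, V)} (hf : Continuous f) (a b : ℝ)
    (θ : Icc (-r) 0) : (∫ s in a..b, f s) θ = ∫ s in a..b, f s θ :=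
  ((ContinuousMap.evalCLM ℂ θ).intervalIntegral_comp_comm (hf.intervalIntegrable a b)).symm

/-- At each `θ` this is additivity of the integral of `x` over the intervals with endpoints `0`,
`t`, `θ`, `t + θ`. The constant segments on the right are what a left null functional annihilates.
-/
lemma primitiveCLM_history_sub (hr : 0 ≤ r) (x : C(ℝ, V)) (t : ℝ) :
    primitiveCLM V hr (history r x t) - primitiveCLM V hr (history r x 0) =
      ∫ s in (0 : ℝ)..t, (history r x s - ContinuousMap.const _ (x s)) := by
  have hc : Continuous fun s => history r x s - ContinuousMap.const _ (x s) :=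
    (continuous_history x).sub (ContinuousMap.continuous_const'.comp x.continuous)
  have hi : ∀ a b, IntervalIntegrable x volume a b := fun a b => x.continuous.intervalIntegrable a b
  ext θ
  rw [intervalIntegral_segment_apply hc, ContinuousMap.sub_apply, primitiveCLM_history,
    primitiveCLM_history]
  simp only [ContinuousMap.sub_apply, history_apply, ContinuousMap.const_apply]
  have h0 : Continuous fun s => x (s + θ) := by fun_prop
  rw [intervalIntegral.integral_sub (h0.intervalIntegrable _ _) (hi _ _),
    intervalIntegral.integral_comp_add_right]
  have h1 := intervalIntegral.integral_add_adjacent_intervals (hi 0 t) (hi t (t + θ))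
  have h2 := intervalIntegral.integral_add_adjacent_intervals (hi 0 (0 + θ)) (hi (0 + θ) (t + θ))
  exact sub_eq_sub_iff_add_eq_add.2
    ((add_comm _ _).trans (h1.trans (h2.symm.trans (add_comm _ _))))

end History

/-! ### The pairing along solutions -/

section Functional

variable {V : Type*} [NormedAddCommGroup V] [NormedSpace ℂ V] {r : ℝ}

/-- The functional `η ↦ ℓ (η 0) - ℓ (L (θ ↦ ∫_0^θ η))` on segments. -/
def pairingCLM (hr : 0 ≤ r) (L : C(Icc (-r) 0, V) →L[ℂ] V) (l : V →L[ℂ] ℂ) :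
    C(Icc (-r) 0, V) →L[ℂ] ℂ :=
  l ∘L (ContinuousMap.evalCLM ℂ ⟨0, neg_nonpos.2 hr, le_rfl⟩ - L ∘L primitiveCLM V hr)

lemma pairingCLM_apply (hr : 0 ≤ r) (L : C(Icc (-r) 0, V) →L[ℂ] V) (l : V →L[ℂ] ℂ)
    (η : C(Icc (-r) 0, V)) : pairingCLM hr L l η =
      l (η ⟨0, neg_nonpos.2 hr, le_rfl⟩) - l (L (primitiveCLM V hr η)) := by
  simp [pairingCLM, ContinuousMap.evalCLM]

/-- `x` solves `x' = L (history x) + f` on `[0, b]` in integrated form. -/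
def SolvesOn (L : C(Icc (-r) 0, V) →L[ℂ] V) (f : ℝ → V) (b : ℝ) (x : C(ℝ, V)) : Prop :=
  ∀ t ∈ Icc 0 b, x t = x 0 + ∫ s in (0 : ℝ)..t, (L (history r x s) + f s)

lemma continuous_comp_history (L : C(Icc (-r) 0, V) →L[ℂ] V) (x : C(ℝ, V)) :
    Continuous fun s => L (history r x s) := L.continuous.comp (continuous_history x)

variable [CompleteSpace V]

/-- By `primitiveCLM_history_sub` and `hl`, the delay term of the pairing changes by `∫ l (L
(history x))`. This is exactly what `L` contributes to `l (x t)`, so only the forcing survives. -/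
theorem SolvesOn.pairingCLM_history {L : C(Icc (-r) 0, V) →L[ℂ] V} {f : ℝ → V} {b : ℝ}
    {x : C(ℝ, V)} (hx : SolvesOn L f b x) (hf : ∀ t, IntervalIntegrable f volume 0 t)
    (hr : 0 ≤ r) {l : V →L[ℂ] ℂ} (hl : ∀ v, l (L (ContinuousMap.const _ v)) = 0)
    {t : ℝ} (ht : t ∈ Icc 0 b) :
    pairingCLM hr L l (history r x t) =
      pairingCLM hr L l (history r x 0) + ∫ s in (0 : ℝ)..t, l (f s) := by
  have hL := (continuous_comp_history (r := r) L x)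
  have hc : Continuous fun s => history r x s - ContinuousMap.const (Icc (-r) 0) (x s) :=
    (continuous_history x).sub (ContinuousMap.continuous_const'.comp x.continuous)
  have h1 : l (L (primitiveCLM V hr (history r x t))) - l (L (primitiveCLM V hr (history r x 0))) =
      ∫ s in (0 : ℝ)..t, l (L (history r x s)) := by
    rw [← map_sub, ← map_sub, primitiveCLM_history_sub]
    have hci : IntervalIntegrable
        (fun s => history r x s - ContinuousMap.const (Icc (-r) 0) (x s)) volume 0 t :=
      hc.intervalIntegrable 0 t
    have := (l ∘L L).intervalIntegral_comp_comm hci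
    simp only [ContinuousLinearMap.comp_apply] at this
    rw [← this]
    simp [hl]
  have h2 : l (x t) = l (x 0) + ((∫ s in (0 : ℝ)..t, l (L (history r x s))) +
      ∫ s in (0 : ℝ)..t, l (f s)) := by
    have hi : IntervalIntegrable (fun s => L (history r x s)) volume 0 t :=
      hL.intervalIntegrable 0 t
    rw [hx t ht, map_add, intervalIntegral.integral_add hi (hf t), map_add,
      l.intervalIntegral_comp_comm hi, l.intervalIntegral_comp_comm (hf t)]
  rw [pairingCLM_apply, pairingCLM_apply]
  simp only [history_apply, add_zero]
  rw [h2, ← h1]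
  ring

end Functional

/-! ### The delay equation as a Volterra equation on `[-r, r]` -/

section Volterra

variable {V : Type*} [NormedAddCommGroup V] {r : ℝ}

/-- Extension of a path on `[-r, r]` to the line by constants. -/
def extendPath (hr : 0 ≤ r) (x : C(Icc (-r) r, V)) : C(ℝ, V) :=
  x.IccExtend (neg_le_self hr)

lemma extendPath_apply (hr : 0 ≤ r) (x : C(Icc (-r) r, V)) (t : ℝ) :
    extendPath hr x t = x (projIcc (-r) r (neg_le_self hr) t) := rfl

lemma norm_history_extendPath_le (hr : 0 ≤ r) (x : C(Icc (-r) r, V)) (s : ℝ) :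
    ‖history r (extendPath hr x) s‖ ≤ ‖x‖ :=
  (ContinuousMap.norm_le _ (norm_nonneg _)).2 fun _ => x.norm_coe_le_norm _

variable [NormedSpace ℂ V]

/-- `t ↦ ∫_0^{t⁺} L (history x s) ds` as a path on `[-r, r]`. -/
def volterraPath (hr : 0 ≤ r) (L : C(Icc (-r) 0, V) →L[ℂ] V) (x : C(Icc (-r) r, V)) :
    C(Icc (-r) r, V) :=
  ⟨fun t => ∫ s in (0 : ℝ)..(max t 0), L (history r (extendPath hr x) s),
    (intervalIntegral.continuous_primitive
      (fun _ _ => (continuous_comp_history L _).intervalIntegrable _ _) 0).comp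
      (continuous_subtype_val.max continuous_const)⟩

lemma norm_volterraPath_le (hr : 0 ≤ r) (L : C(Icc (-r) 0, V) →L[ℂ] V) (x : C(Icc (-r) r, V)) :
    ‖volterraPath hr L x‖ ≤ ‖L‖ * r * ‖x‖ := by
  refine (ContinuousMap.norm_le _ (by positivity)).2 fun t => ?_
  have h := intervalIntegral.norm_integral_le_of_norm_le_const (a := 0) (b := max (t : ℝ) 0)
    (f := fun s => L (history r (extendPath hr x) s)) (C := ‖L‖ * ‖x‖) fun s _ =>
      (L.le_opNorm _).trans (by gcongr; exact norm_history_extendPath_le hr x s)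
  refine h.trans ?_
  rw [mul_right_comm]
  gcongr
  rw [sub_zero, abs_of_nonneg (le_max_right _ _)]
  exact max_le t.2.2 hr

/-- The Volterra operator of the delay equation `x' = L (history x)` on `[-r, r]`. -/
def volterraCLM (hr : 0 ≤ r) (L : C(Icc (-r) 0, V) →L[ℂ] V) :
    C(Icc (-r) r, V) →L[ℂ] C(Icc (-r) r, V) :=
  LinearMap.mkContinuous
    { toFun := volterraPath hr L
      map_add' := fun x y => by
        ext t
        have h : ∀ s, L (history r (extendPath hr (x + y)) s) =
            L (history r (extendPath hr x) s) + L (history r (extendPath hr y) s) := fun s => by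
          rw [← map_add]; rfl
        simp only [volterraPath, ContinuousMap.coe_mk, ContinuousMap.add_apply, h]
        exact intervalIntegral.integral_add
          ((continuous_comp_history L _).intervalIntegrable _ _)
          ((continuous_comp_history L _).intervalIntegrable _ _)
      map_smul' := fun c x => by
        ext t
        have h : ∀ s, L (history r (extendPath hr (c • x)) s) =
            c • L (history r (extendPath hr x) s) := fun s => by
          rw [← map_smul]; rfl
        simp [volterraPath, h] } (‖L‖ * r) (norm_volterraPath_le hr L)

lemma volterraCLM_apply (hr : 0 ≤ r) (L : C(Icc (-r) 0, V) →L[ℂ] V) (x : C(Icc (-r) r, V))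
    (t : Icc (-r) r) : volterraCLM hr L x t =
      ∫ s in (0 : ℝ)..(max t 0), L (history r (extendPath hr x) s) := rfl

/-- Arzelà–Ascoli. Pointwise compactness is Tychonoff: the Lipschitz bound is closed under pointwise
limits and makes continuity of the limit automatic. -/
lemma isCompact_lipschitz_paths {W : Type*} [NormedAddCommGroup W] [ProperSpace W]
    {K : Type*} [PseudoMetricSpace K] [CompactSpace K] (B : ℝ) (C : ℝ≥0) :
    IsCompact {f : C(K, W) | (∀ t, ‖f t‖ ≤ B) ∧ LipschitzWith C f} := by
  refine ArzelaAscoli.isCompact_of_equicontinuous _ ?_ ?_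
  · have himage : ContinuousMap.toFun '' {f : C(K, W) | (∀ t, ‖f t‖ ≤ B) ∧ LipschitzWith C f} =
        (univ.pi fun _ => Metric.closedBall (0 : W) B) ∩
          {f | ∀ s t, dist (f s) (f t) ≤ C * dist s t} := by
      ext f
      constructor
      · rintro ⟨g, ⟨h1, h2⟩, rfl⟩
        exact ⟨fun t _ => by simpa using h1 t, fun s t => h2.dist_le_mul s t⟩
      · rintro ⟨h1, h2⟩
        have h3 : LipschitzWith C f := LipschitzWith.of_dist_le_mul h2
        exact ⟨⟨f, h3.continuous⟩, ⟨fun t => by simpa using h1 t (mem_univ t), h3⟩, rfl⟩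
    rw [himage]
    refine (isCompact_univ_pi fun _ => isCompact_closedBall _ _).inter_right ?_
    simp only [Set.ofPred_forall]
    exact isClosed_iInter fun s => isClosed_iInter fun t =>
      isClosed_le ((continuous_apply s).dist (continuous_apply t)) continuous_const
  · exact (LipschitzWith.uniformEquicontinuous _ C fun f => f.2.2).equicontinuous

theorem isCompactOperator_volterraCLM [FiniteDimensional ℂ V] (hr : 0 ≤ r)
    (L : C(Icc (-r) 0, V) →L[ℂ] V) : IsCompactOperator (volterraCLM hr L) := by
  have : ProperSpace V := FiniteDimensional.proper ℂ V
  rw [isCompactOperator_iff_exists_mem_nhds_image_subset_compact]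
  refine ⟨Metric.closedBall 0 1, Metric.closedBall_mem_nhds _ one_pos, _,
    isCompact_lipschitz_paths (‖L‖ * r) ‖L‖₊, ?_⟩
  rintro _ ⟨x, hx, rfl⟩
  have hx' : ‖x‖ ≤ 1 := by simpa using hx
  refine ⟨fun t => (ContinuousMap.norm_coe_le_norm _ t).trans
    ((norm_volterraPath_le hr L x).trans (mul_le_of_le_one_right (by positivity) hx')),
    LipschitzWith.of_dist_le_mul fun s t => ?_⟩
  have hi : ∀ a b, IntervalIntegrable (fun s => L (history r (extendPath hr x) s)) volume a b :=
    fun _ _ => (continuous_comp_history L _).intervalIntegrable _ _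
  rw [dist_eq_norm, volterraCLM_apply, volterraCLM_apply,
    intervalIntegral.integral_interval_sub_left (hi _ _) (hi _ _)]
  refine (intervalIntegral.norm_integral_le_of_norm_le_const (C := ‖L‖) fun s _ =>
    (L.le_opNorm _).trans (mul_le_of_le_one_right (norm_nonneg _)
      ((norm_history_extendPath_le hr x s).trans hx'))).trans ?_
  rw [coe_nnnorm, Subtype.dist_eq, Real.dist_eq]
  exact mul_le_mul_of_nonneg_left (abs_max_sub_max_le_abs (s : ℝ) t 0) L.opNorm_nonneg

/-- Iterating the fixed-point equation gains a factor `‖L‖ t / m` each time, so the factorial wins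
whatever the size of `‖L‖ r`. -/
theorem eq_zero_of_volterraCLM_eq (hr : 0 ≤ r) {L : C(Icc (-r) 0, V) →L[ℂ] V}
    {x : C(Icc (-r) r, V)} (hx : volterraCLM hr L x = x) : x = 0 := by
  have key : ∀ m : ℕ, ∀ t : Icc (-r) r,
      ‖x t‖ ≤ ‖x‖ * (‖L‖ * max (t : ℝ) 0) ^ m / m.factorial := by
    intro m
    induction m with
    | zero => intro t; simpa using x.norm_coe_le_norm t
    | succ m ih =>
      intro t
      set τ := max (t : ℝ) 0 with hτ
      have hτ0 : 0 ≤ τ := le_max_right _ _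
      have hbound : ∀ s ∈ Ioc 0 τ, ‖L (history r (extendPath hr x) s)‖ ≤
          ‖L‖ * (‖x‖ * (‖L‖ * s) ^ m / m.factorial) := fun s hs => by
        have hs0 : 0 ≤ s := hs.1.le
        refine (L.le_opNorm _).trans ?_
        gcongr
        -- The history at time `s` sees the path only up to `s`, so the induction hypothesis may be
        -- used with `s` as upper bound.
        refine (ContinuousMap.norm_le _ (by positivity)).2 fun θ => ?_
        rw [history_apply, extendPath_apply]
        refine (ih _).trans ?_
        gcongr
        refine max_le ?_ hs0
        rw [coe_projIcc]
        refine max_le (by linarith) ((min_le_right _ _).trans (by linarith [θ.2.2]))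
      have hcont : Continuous fun s : ℝ => ‖L‖ * (‖x‖ * (‖L‖ * s) ^ m / m.factorial) := by
        fun_prop
      have h := intervalIntegral.norm_integral_le_of_norm_le hτ0
        (Filter.Eventually.of_forall hbound) (hcont.intervalIntegrable (μ := volume) 0 τ)
      rw [← volterraCLM_apply, hx] at h
      refine h.trans (le_of_eq ?_)
      have : (fun s : ℝ => ‖L‖ * (‖x‖ * (‖L‖ * s) ^ m / m.factorial)) =
          fun s => (‖L‖ * ‖x‖ * ‖L‖ ^ m / m.factorial) * s ^ m := by
        funext s; rw [mul_pow]; ring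
      rw [this, intervalIntegral.integral_const_mul, integral_pow, Nat.factorial_succ]
      push_cast
      field_simp
      ring
  ext t
  have hlim := ((FloorSemiring.tendsto_pow_div_factorial_atTop
    (‖L‖ * max (t : ℝ) 0)).const_mul ‖x‖)
  rw [mul_zero] at hlim
  have : ‖x t‖ ≤ 0 := ge_of_tendsto' hlim fun m => by
    rw [← mul_div_assoc]; exact key m t
  simpa using this

/-- Fredholm alternative: a compact operator without eigenvalue `1` has `1` in its resolvent set.
The two identities give uniqueness and existence for the delay equation. -/
theorem exists_leftInverse_one_sub_volterraCLM [FiniteDimensional ℂ V] (hr : 0 ≤ r)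
    (L : C(Icc (-r) 0, V) →L[ℂ] V) :
    ∃ Q : C(Icc (-r) r, V) →L[ℂ] C(Icc (-r) r, V),
      (∀ x, Q (x - volterraCLM hr L x) = x) ∧ ∀ x, Q x = x + volterraCLM hr L (Q x) := by
  have : CompleteSpace V := FiniteDimensional.complete ℂ V
  have hunit : IsUnit (1 - volterraCLM hr L) := by
    rcases (isCompactOperator_volterraCLM hr L).hasEigenvalue_or_mem_resolventSet
      (one_ne_zero (α := ℂ)) with h | h
    · obtain ⟨x, hx⟩ := h.exists_hasEigenvector
      exact absurd (eq_zero_of_volterraCLM_eq hr (by simpa using hx.apply_eq_smul)) hx.2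
    · simpa [spectrum.mem_resolventSet_iff] using h
  obtain ⟨u, hu⟩ := hunit
  refine ⟨(↑u⁻¹ : _ →L[ℂ] _), fun x => ?_, fun x => ?_⟩
  · have := congrArg (fun A : C(Icc (-r) r, V) →L[ℂ] C(Icc (-r) r, V) => A x) u.inv_mul
    simpa [hu] using this
  · have := congrArg (fun A : C(Icc (-r) r, V) →L[ℂ] C(Icc (-r) r, V) => A x) u.mul_inv
    rw [hu] at this
    exact sub_eq_iff_eq_add.1 (by simpa using this)

end Volterra

/-! ### The time-`r` solution operator and its response to forcing -/

section SolutionOperator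

variable {V : Type*} [NormedAddCommGroup V] {r : ℝ}

/-- Restriction of a path on the line to `[-r, r]`. -/
def restrictPath (r : ℝ) (x : C(ℝ, V)) : C(Icc (-r) r, V) :=
  x.comp ⟨Subtype.val, continuous_subtype_val⟩

lemma history_extendPath_restrictPath (hr : 0 ≤ r) (x : C(ℝ, V)) {s : ℝ} (hs : s ∈ Icc 0 r) :
    history r (extendPath hr (restrictPath r x)) s = history r x s := by
  ext θ
  have h : s + (θ : ℝ) ∈ Icc (-r) r := ⟨by linarith [hs.1, θ.2.1], by linarith [hs.2, θ.2.2]⟩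
  rw [history_apply, history_apply, extendPath_apply, projIcc_of_mem _ h]
  rfl

variable [NormedSpace ℂ V]

/-- Extension of a segment to `[-r, r]` by its value at `0`. -/
def extendSegment (V : Type*) [NormedAddCommGroup V] [NormedSpace ℂ V] (hr : 0 ≤ r) :
    C(Icc (-r) 0, V) →L[ℂ] C(Icc (-r) r, V) :=
  ContinuousMap.compCLM ℂ V ⟨fun t => projIcc (-r) 0 (neg_nonpos.2 hr) (t : ℝ),
    continuous_projIcc.comp continuous_subtype_val⟩

/-- The last segment of a path on `[-r, r]`. -/
def lastSegment (V : Type*) [NormedAddCommGroup V] [NormedSpace ℂ V] (hr : 0 ≤ r) :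
    C(Icc (-r) r, V) →L[ℂ] C(Icc (-r) 0, V) :=
  ContinuousMap.compCLM ℂ V ⟨fun θ => projIcc (-r) r (neg_le_self hr) (r + (θ : ℝ)),
    continuous_projIcc.comp (by fun_prop)⟩

lemma extendSegment_apply (hr : 0 ≤ r) (η : C(Icc (-r) 0, V)) (t : Icc (-r) r) :
    extendSegment V hr η t = η (projIcc (-r) 0 (neg_nonpos.2 hr) t) := rfl

lemma norm_extendSegment_le (hr : 0 ≤ r) (η : C(Icc (-r) 0, V)) :
    ‖extendSegment V hr η‖ ≤ ‖η‖ :=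
  (ContinuousMap.norm_le _ (norm_nonneg _)).2 fun _ => η.norm_coe_le_norm _

lemma lastSegment_eq_history (hr : 0 ≤ r) (x : C(Icc (-r) r, V)) :
    lastSegment V hr x = history r (extendPath hr x) r := rfl

lemma norm_lastSegment_le (hr : 0 ≤ r) (x : C(Icc (-r) r, V)) : ‖lastSegment V hr x‖ ≤ ‖x‖ :=
  norm_history_extendPath_le hr x r

variable [FiniteDimensional ℂ V]

/-- The inverse of `1 - volterraCLM`. -/
def resolventCLM (hr : 0 ≤ r) (L : C(Icc (-r) 0, V) →L[ℂ] V) :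
    C(Icc (-r) r, V) →L[ℂ] C(Icc (-r) r, V) :=
  (exists_leftInverse_one_sub_volterraCLM hr L).choose

lemma resolventCLM_sub (hr : 0 ≤ r) (L : C(Icc (-r) 0, V) →L[ℂ] V) (x : C(Icc (-r) r, V)) :
    resolventCLM hr L (x - volterraCLM hr L x) = x :=
  (exists_leftInverse_one_sub_volterraCLM hr L).choose_spec.1 x

lemma resolventCLM_eq_add (hr : 0 ≤ r) (L : C(Icc (-r) 0, V) →L[ℂ] V) (x : C(Icc (-r) r, V)) :
    resolventCLM hr L x = x + volterraCLM hr L (resolventCLM hr L x) :=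
  (exists_leftInverse_one_sub_volterraCLM hr L).choose_spec.2 x

/-- The time-`r` solution operator of `x' = L (history x)`. -/
def solutionOp (hr : 0 ≤ r) (L : C(Icc (-r) 0, V) →L[ℂ] V) :
    C(Icc (-r) 0, V) →L[ℂ] C(Icc (-r) 0, V) :=
  lastSegment V hr ∘L resolventCLM hr L ∘L extendSegment V hr

/-- The solution of `x' = L (history x)` on `[0, r]` with given initial segment. -/
def flow (hr : 0 ≤ r) (L : C(Icc (-r) 0, V) →L[ℂ] V) (η : C(Icc (-r) 0, V)) : C(ℝ, V) :=
  extendPath hr (resolventCLM hr L (extendSegment V hr η))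

lemma flow_of_mem (hr : 0 ≤ r) (L : C(Icc (-r) 0, V) →L[ℂ] V) (η : C(Icc (-r) 0, V))
    {t : ℝ} (ht : t ∈ Icc (-r) r) :
    flow hr L η t = η (projIcc (-r) 0 (neg_nonpos.2 hr) t) +
      ∫ s in (0 : ℝ)..(max t 0), L (history r (flow hr L η) s) := by
  have h := congrArg (fun x : C(Icc (-r) r, V) => x ⟨t, ht⟩)
    (resolventCLM_eq_add hr L (extendSegment V hr η))
  rw [flow, extendPath_apply, projIcc_of_mem _ ht]
  exact h

lemma history_flow_zero (hr : 0 ≤ r) (L : C(Icc (-r) 0, V) →L[ℂ] V) (η : C(Icc (-r) 0, V)) :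
    history r (flow hr L η) 0 = η := by
  ext θ
  rw [history_apply, zero_add, flow_of_mem hr L η ⟨θ.2.1, θ.2.2.trans hr⟩, projIcc_val,
    max_eq_right θ.2.2, intervalIntegral.integral_same, add_zero]

lemma history_flow_delay (hr : 0 ≤ r) (L : C(Icc (-r) 0, V) →L[ℂ] V) (η : C(Icc (-r) 0, V)) :
    history r (flow hr L η) r = solutionOp hr L η := rfl

lemma flow_zero (hr : 0 ≤ r) (L : C(Icc (-r) 0, V) →L[ℂ] V) (η : C(Icc (-r) 0, V)) :
    flow hr L η 0 = η (projIcc (-r) 0 (neg_nonpos.2 hr) 0) := by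
  rw [flow_of_mem hr L η ⟨neg_nonpos.2 hr, hr⟩, max_self, intervalIntegral.integral_same, add_zero]

lemma solvesOn_flow (hr : 0 ≤ r) (L : C(Icc (-r) 0, V) →L[ℂ] V) (η : C(Icc (-r) 0, V)) :
    SolvesOn L 0 r (flow hr L η) := by
  intro t ht
  rw [flow_zero, flow_of_mem hr L η ⟨(neg_nonpos.2 hr).trans ht.1, ht.2⟩, max_eq_left ht.1,
    projIcc_of_right_le _ ht.1, projIcc_of_right_le _ le_rfl]
  simp

/-- The resolvent `Q` satisfies `Q = 1 + K Q` with `K` the Volterra operator. The part from `1` has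
finite rank: after a full delay the last segment sees only the extension by the constant `η 0`. The
other part factors through the compact `K`. -/
theorem isCompactOperator_solutionOp (hr : 0 ≤ r) (L : C(Icc (-r) 0, V) →L[ℂ] V) :
    IsCompactOperator (solutionOp hr L) := by
  have : ProperSpace V := FiniteDimensional.proper ℂ V
  let e : C(Icc (-r) 0, V) →L[ℂ] V := ContinuousMap.evalCLM ℂ ⟨0, neg_nonpos.2 hr, le_rfl⟩
  let c : V →L[ℂ] C(Icc (-r) 0, V) := LinearMap.mkContinuous
    { toFun := fun v => ContinuousMap.const _ v
      map_add' := fun _ _ => rfl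
      map_smul' := fun _ _ => rfl } 1 fun v => by
    rw [one_mul]
    exact (ContinuousMap.norm_le _ (norm_nonneg _)).2 fun _ => le_rfl
  have h1 : IsCompactOperator (c ∘L e) :=
    (isCompactOperator_of_locallyCompactSpace_dom e).clm_comp c
  have h2 : IsCompactOperator
      (lastSegment V hr ∘L volterraCLM hr L ∘L resolventCLM hr L ∘L extendSegment V hr) :=
    ((isCompactOperator_volterraCLM hr L).comp_clm
      (resolventCLM hr L ∘L extendSegment V hr)).clm_comp (lastSegment V hr)
  refine cast (congrArg IsCompactOperator (funext fun η => ?_)) (h1.add h2)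
  symm
  have h := resolventCLM_eq_add hr L (extendSegment V hr η)
  change lastSegment V hr (resolventCLM hr L (extendSegment V hr η)) =
    c (e η) + lastSegment V hr (volterraCLM hr L (resolventCLM hr L (extendSegment V hr η)))
  conv_lhs => rw [h, map_add]
  congr 1
  ext θ
  change η (projIcc (-r) 0 (neg_nonpos.2 hr) (projIcc (-r) r (neg_le_self hr) (r + (θ : ℝ)))) =
    η ⟨0, neg_nonpos.2 hr, le_rfl⟩
  rw [projIcc_of_right_le]
  rw [coe_projIcc]
  exact le_max_of_le_right (le_min hr (by linarith [θ.2.1]))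

/-- The forcing enters the Volterra equation only through its primitive, an additive datum `g` of
size at most `r M`; the resolvent then gives every perturbation bound on one delay interval. -/
theorem SolvesOn.exists_restrictPath_eq (hr : 0 ≤ r) {L : C(Icc (-r) 0, V) →L[ℂ] V} {f : ℝ → V}
    {x : C(ℝ, V)} (hx : SolvesOn L f r x) (hf : ∀ t, IntervalIntegrable f volume 0 t)
    {M : ℝ} (hM : ∀ t ∈ Icc 0 r, ‖f t‖ ≤ M) :
    ∃ g : C(Icc (-r) r, V), ‖g‖ ≤ r * M ∧
      restrictPath r x = resolventCLM hr L (extendSegment V hr (history r x 0) + g) := by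
  have hM0 : 0 ≤ M := (norm_nonneg _).trans (hM 0 ⟨le_rfl, hr⟩)
  let y := restrictPath r x
  refine ⟨y - volterraCLM hr L y - extendSegment V hr (history r x 0),
    (ContinuousMap.norm_le _ (by positivity)).2 fun t => ?_, ?_⟩
  · have hτ : max (t : ℝ) 0 ∈ Icc 0 r := ⟨le_max_right _ _, max_le t.2.2 hr⟩
    have hL : ∀ s ∈ uIcc 0 (max (t : ℝ) 0),
        L (history r (extendPath hr y) s) = L (history r x s) := fun s hs => by
      rw [uIcc_of_le hτ.1] at hs
      rw [history_extendPath_restrictPath hr x ⟨hs.1, hs.2.trans hτ.2⟩]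
    have heq : (y - volterraCLM hr L y - extendSegment V hr (history r x 0)) t =
        ∫ s in (0 : ℝ)..max (t : ℝ) 0, f s := by
      rw [ContinuousMap.sub_apply, ContinuousMap.sub_apply, volterraCLM_apply,
        intervalIntegral.integral_congr hL, extendSegment_apply, history_apply, zero_add]
      have hs := hx _ hτ
      rw [intervalIntegral.integral_add ((continuous_comp_history L x).intervalIntegrable _ _)
        (hf _)] at hs
      rcases le_total (t : ℝ) 0 with h0 | h0
      · rw [max_eq_right h0, projIcc_of_mem _ ⟨t.2.1, h0⟩]
        simp [y, restrictPath]
      · rw [max_eq_left h0] at hs ⊢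
        rw [projIcc_of_right_le _ h0]
        change x t - _ - x 0 = _
        rw [hs]
        abel
    rw [heq]
    refine (intervalIntegral.norm_integral_le_of_norm_le_const (C := M) fun s hs => ?_).trans ?_
    · rw [uIoc_of_le hτ.1] at hs
      exact hM s ⟨hs.1.le, hs.2.trans hτ.2⟩
    · rw [sub_zero, abs_of_nonneg hτ.1, mul_comm]
      gcongr
      exact hτ.2
  · rw [add_sub_cancel, resolventCLM_sub]

theorem SolvesOn.norm_history_sub_solutionOp_le (hr : 0 ≤ r) {L : C(Icc (-r) 0, V) →L[ℂ] V}
    {f : ℝ → V} {x : C(ℝ, V)} (hx : SolvesOn L f r x)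
    (hf : ∀ t, IntervalIntegrable f volume 0 t) {M : ℝ} (hM : ∀ t ∈ Icc 0 r, ‖f t‖ ≤ M) :
    ‖history r x r - solutionOp hr L (history r x 0)‖ ≤ ‖resolventCLM hr L‖ * (r * M) := by
  obtain ⟨g, hg, hxg⟩ := hx.exists_restrictPath_eq hr hf hM
  rw [← history_extendPath_restrictPath hr x ⟨hr, le_rfl⟩, ← lastSegment_eq_history, hxg]
  change ‖_ - lastSegment V hr (resolventCLM hr L (extendSegment V hr (history r x 0)))‖ ≤ _
  rw [← map_sub, ← map_sub, add_sub_cancel_left]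
  exact (norm_lastSegment_le hr _).trans ((ContinuousLinearMap.le_opNorm _ _).trans (by gcongr))

theorem SolvesOn.norm_history_le (hr : 0 ≤ r) {L : C(Icc (-r) 0, V) →L[ℂ] V}
    {f : ℝ → V} {x : C(ℝ, V)} (hx : SolvesOn L f r x)
    (hf : ∀ t, IntervalIntegrable f volume 0 t) {M : ℝ} (hM : ∀ t ∈ Icc 0 r, ‖f t‖ ≤ M)
    {t : ℝ} (ht : t ∈ Icc 0 r) :
    ‖history r x t‖ ≤ ‖resolventCLM hr L‖ * (‖history r x 0‖ + r * M) := by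
  obtain ⟨g, hg, hxg⟩ := hx.exists_restrictPath_eq hr hf hM
  rw [← history_extendPath_restrictPath hr x ht]
  refine (norm_history_extendPath_le hr _ _).trans ?_
  rw [hxg]
  exact (ContinuousLinearMap.le_opNorm _ _).trans (by
    gcongr
    exact (norm_add_le _ _).trans (add_le_add (norm_extendSegment_le hr _) hg))

end SolutionOperator

/-! ### Floquet solutions and the characteristic equation -/

section Floquet

variable {V : Type*} [NormedAddCommGroup V] [NormedSpace ℂ V] {r : ℝ}

/-- The segment `θ ↦ e^{z θ} v`. -/
def expSegment (r : ℝ) (z : ℂ) (v : V) : C(Icc (-r) 0, V) :=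
  ⟨fun θ => Complex.exp (z * (θ : ℝ)) • v, by fun_prop⟩

@[simp] lemma expSegment_apply (z : ℂ) (v : V) (θ : Icc (-r) 0) :
    expSegment r z v θ = Complex.exp (z * (θ : ℝ)) • v := rfl

lemma expSegment_zero (v : V) : expSegment r 0 v = ContinuousMap.const _ v := by
  ext θ
  simp

lemma continuous_exp_smul (z : ℂ) (x : C(ℝ, V)) :
    Continuous fun s : ℝ => Complex.exp (-z * s) • x s := by fun_prop

lemma continuous_exp_smul_history (z : ℂ) (x : C(ℝ, V)) :
    Continuous fun s : ℝ => Complex.exp (-z * s) • history r x s := by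
  have := continuous_history (r := r) x
  fun_prop

variable [CompleteSpace V]

/-- The function `e^{-zs} x(s)` repeats after time `r`, so shifting the period of integration by `θ`
changes nothing. -/
theorem expSegment_integral {x : C(ℝ, V)} {z : ℂ}
    (hper : ∀ θ ∈ Icc (-r) 0, x (r + θ) = Complex.exp (z * r) • x θ) :
    expSegment r z (∫ s in (0 : ℝ)..r, Complex.exp (-z * s) • x s) =
      ∫ s in (0 : ℝ)..r, Complex.exp (-z * s) • history r x s := by
  ext θ
  rw [intervalIntegral_segment_apply (continuous_exp_smul_history z x)]
  let g : ℝ → V := fun s => Complex.exp (-z * s) • x s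
  have hi : ∀ a b, IntervalIntegrable g volume a b := fun a b =>
    (continuous_exp_smul z x).intervalIntegrable a b
  have hg : ∀ s ∈ uIcc (θ : ℝ) 0, g s = g (r + s) := fun s hs => by
    rw [uIcc_of_le θ.2.2] at hs
    simp only [g]
    rw [hper s ⟨θ.2.1.trans hs.1, hs.2⟩, smul_smul, ← Complex.exp_add]
    congr 2
    push_cast
    ring
  have h1 : ∫ s in (0 : ℝ)..r, Complex.exp (-z * s) • history r x s θ =
      ∫ s in (0 : ℝ)..r, Complex.exp (z * (θ : ℝ)) • g (s + θ) := by
    refine intervalIntegral.integral_congr fun s _ => ?_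
    simp only [g, history_apply, smul_smul, ← Complex.exp_add]
    congr 2
    push_cast
    ring
  have h2 : ∫ s in (0 : ℝ)..r, g (s + θ) = ∫ s in (0 : ℝ)..r, g s := by
    rw [intervalIntegral.integral_comp_add_right, zero_add,
      ← intervalIntegral.integral_add_adjacent_intervals (hi θ 0) (hi 0 (r + θ)),
      intervalIntegral.integral_congr hg, intervalIntegral.integral_comp_add_left, add_zero,
      add_comm, intervalIntegral.integral_add_adjacent_intervals (hi _ _) (hi _ _)]
  simp only [ContinuousMap.smul_apply]
  rw [h1, intervalIntegral.integral_smul, h2, expSegment_apply]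

/-- Integration by parts over a period; the Floquet relation cancels the boundary terms. -/
theorem SolvesOn.smul_integral_eq (hr : 0 ≤ r) {L : C(Icc (-r) 0, V) →L[ℂ] V} {x : C(ℝ, V)}
    (hx : SolvesOn L 0 r x) {z : ℂ}
    (hper : ∀ θ ∈ Icc (-r) 0, x (r + θ) = Complex.exp (z * r) • x θ) :
    z • (∫ s in (0 : ℝ)..r, Complex.exp (-z * s) • x s) =
      L (expSegment r z (∫ s in (0 : ℝ)..r, Complex.exp (-z * s) • x s)) := by
  have hL := continuous_comp_history (r := r) L x
  rw [expSegment_integral hper, ← L.intervalIntegral_comp_comm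
    ((continuous_exp_smul_history z x).intervalIntegrable _ _)]
  simp only [map_smul]
  -- `y` is differentiable on the whole line and agrees with `x` on `[0, r]`; `x` itself need not be
  -- differentiable at the endpoints.
  let y : ℝ → V := fun t => x 0 + ∫ s in (0 : ℝ)..t, L (history r x s)
  have hxy : ∀ t ∈ Icc 0 r, x t = y t := fun t ht => by simpa using hx t ht
  have hy : ∀ t, HasDerivAt y (L (history r x t)) t := fun t =>
    (intervalIntegral.integral_hasDerivAt_right (hL.intervalIntegrable _ _)
      (hL.stronglyMeasurableAtFilter _ _) hL.continuousAt).const_add _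
  have hyc : Continuous y := continuous_iff_continuousAt.2 fun t => (hy t).continuousAt
  have he : ∀ t : ℝ, HasDerivAt (fun s : ℝ => Complex.exp (-z * s))
      (Complex.exp (-z * t) * (-z)) t := fun t => by
    have h := ((hasDerivAt_id t).ofReal_comp.const_mul (-z)).cexp
    simpa using h
  have hi1 : IntervalIntegrable (fun t : ℝ => Complex.exp (-z * t) • L (history r x t))
      volume 0 r := by
    refine Continuous.intervalIntegrable (Continuous.smul ?_ hL) _ _
    fun_prop
  have hi2 : IntervalIntegrable (fun t : ℝ => (Complex.exp (-z * t) * (-z)) • y t)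
      volume 0 r := Continuous.intervalIntegrable (by fun_prop) _ _
  have hft := intervalIntegral.integral_eq_sub_of_hasDerivAt
    (fun t _ => (he t).smul (hy t)) (hi1.add hi2)
  simp only [Pi.smul_apply'] at hft
  rw [intervalIntegral.integral_add hi1 hi2, ← hxy r ⟨hr, le_rfl⟩, ← hxy 0 ⟨le_rfl, hr⟩] at hft
  have hend : x r = Complex.exp (z * r) • x 0 := by simpa using hper 0 ⟨neg_nonpos.2 hr, le_rfl⟩
  rw [hend, smul_smul, ← Complex.exp_add] at hft
  have hz : ∫ t in (0 : ℝ)..r, (Complex.exp (-z * t) * (-z)) • y t =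
      -(z • ∫ s in (0 : ℝ)..r, Complex.exp (-z * s) • x s) := by
    rw [← neg_smul, ← intervalIntegral.integral_smul]
    refine intervalIntegral.integral_congr fun s hs => ?_
    rw [uIcc_of_le hr] at hs
    rw [hxy s hs, smul_smul, mul_comm]
  rw [hz, ← sub_eq_add_neg] at hft
  simp only [neg_mul, neg_add_cancel, Complex.exp_zero, one_smul, Complex.ofReal_zero, mul_zero,
    sub_self] at hft
  simpa using (sub_eq_zero.1 hft).symm

/-- Parseval for each `φ ∘ g` with `φ` in the dual; continuity upgrades a zero `L²` norm to
pointwise vanishing, endpoints included. -/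
theorem eqOn_zero_of_fourier_integral_eq_zero {b : ℝ} (hb : 0 < b) {g : ℝ → V}
    (hg : Continuous g) (h : ∀ k : ℤ, ∫ s in (0 : ℝ)..b,
      Complex.exp (-(2 * Real.pi * Complex.I * k / b) * s) • g s = 0) :
    ∀ s ∈ Icc 0 b, g s = 0 := by
  intro s hs
  refine SeparatingDual.eq_zero_of_forall_dual_eq_zero (R := ℂ) fun φ => ?_
  have hφ : Continuous fun t => φ (g t) := φ.continuous.comp hg
  have hcoeff : ∀ k : ℤ, fourierCoeffOn hb (fun t => φ (g t)) k = 0 := fun k => by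
    have hi : IntervalIntegrable (fun s : ℝ =>
        Complex.exp (-(2 * Real.pi * Complex.I * k / b) * s) • g s) volume 0 b :=
      Continuous.intervalIntegrable (by fun_prop) _ _
    have h0 := φ.intervalIntegral_comp_comm hi
    rw [h k, map_zero] at h0
    rw [fourierCoeffOn_eq_integral]
    refine (smul_eq_zero_of_right _ (Eq.trans ?_ h0))
    refine intervalIntegral.integral_congr fun t _ => ?_
    simp only [fourier_coe_apply, map_smul]
    congr 2
    push_cast
    ring
  have hL2 : MemLp (fun t => φ (g t)) 2 (volume.restrict (Ioc 0 b)) := by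
    obtain ⟨B, hB⟩ := isCompact_Icc.exists_bound_of_continuousOn (s := Icc 0 b) hφ.continuousOn
    exact MemLp.of_bound hφ.aestronglyMeasurable B
      (ae_restrict_of_forall_mem measurableSet_Ioc fun t ht => hB t ⟨ht.1.le, ht.2⟩)
  have hsum := hasSum_sq_fourierCoeffOn hb hL2
  simp only [hcoeff, norm_zero, ne_eq, OfNat.ofNat_ne_zero, not_false_eq_true, zero_pow] at hsum
  have hint := hsum.unique hasSum_zero
  by_contra hne
  have hpos := intervalIntegral.integral_pos hb (hφ.norm.pow 2).continuousOn
    (fun t _ => sq_nonneg _) ⟨s, hs, pow_pos (norm_pos_iff.2 hne) 2⟩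
  rcases smul_eq_zero.1 hint with h1 | h1
  · simp [hb.ne'] at h1
  · exact hpos.ne' h1

/-- A Floquet solution with a multiplier of modulus at least one vanishes, if the characteristic
equation has no nonzero solution in the closed right half-plane on the kernel of the functional. -/
theorem SolvesOn.history_eq_zero_of_floquet (hr : 0 < r) {L : C(Icc (-r) 0, V) →L[ℂ] V}
    {x : C(ℝ, V)} (hx : SolvesOn L 0 r x) {m : ℂ} (hm : 1 ≤ ‖m‖)
    (hper : ∀ θ ∈ Icc (-r) 0, x (r + θ) = m • x θ) {l : V →L[ℂ] ℂ}
    (hl : ∀ v, l (L (ContinuousMap.const _ v)) = 0)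
    (hchar : ∀ (z : ℂ) (v : V), 0 ≤ z.re → z ≠ 0 → z • v = L (expSegment r z v) → v = 0)
    (hker : ∀ v, L (ContinuousMap.const _ v) = 0 →
      pairingCLM hr.le L l (ContinuousMap.const _ v) = 0 → v = 0)
    (hp : pairingCLM hr.le L l (history r x 0) = 0) : history r x 0 = 0 := by
  have hm0 : m ≠ 0 := norm_pos_iff.1 (one_pos.trans_le hm)
  have hr' : (r : ℂ) ≠ 0 := by exact_mod_cast hr.ne'
  have hmoment : ∀ z : ℂ, Complex.exp (z * r) = m →
      ∫ s in (0 : ℝ)..r, Complex.exp (-z * s) • x s = 0 := by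
    intro z hz
    have hper' : ∀ θ ∈ Icc (-r) 0, x (r + θ) = Complex.exp (z * r) • x θ := by rwa [hz]
    have hev := hx.smul_integral_eq hr.le hper'
    by_cases hz0 : z = 0
    -- Here `m = 1`. The constant segment of the moment is the integral of the histories over a
    -- period, and each of these has pairing zero because the pairing is conserved.
    · subst hz0
      refine hker _ ?_ ?_
      · rw [← expSegment_zero, ← hev, zero_smul]
      · rw [← expSegment_zero, expSegment_integral hper',
          ← (pairingCLM hr.le L l).intervalIntegral_comp_comm
            ((continuous_exp_smul_history 0 x).intervalIntegrable _ _)]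
        refine (intervalIntegral.integral_congr fun s hs => ?_).trans
          intervalIntegral.integral_zero
        rw [uIcc_of_le hr.le] at hs
        have := hx.pairingCLM_history (fun _ => intervalIntegrable_const) hr.le hl hs
        simp [this, hp]
    · refine hchar z _ ?_ hz0 hev
      have h1 : 1 ≤ Real.exp (z.re * r) := by
        rw [← hz, Complex.norm_exp] at hm
        simpa using hm
      exact nonneg_of_mul_nonneg_left (Real.one_le_exp_iff.1 h1) hr
  -- The exponents `z₀ + 2πik/r` all satisfy `e^{zr} = m`, and they shift `z₀` by the Fourier
  -- frequencies of `[0, r]`.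
  let z₀ : ℂ := Complex.log m / r
  have hz₀ : Complex.exp (z₀ * r) = m := by
    rw [div_mul_cancel₀ _ hr', Complex.exp_log hm0]
  have hzero := eqOn_zero_of_fourier_integral_eq_zero hr (continuous_exp_smul z₀ x) fun k => by
    rw [← hmoment (z₀ + 2 * Real.pi * Complex.I * k / r) ?_]
    · refine intervalIntegral.integral_congr fun s _ => ?_
      simp only [smul_smul, ← Complex.exp_add]
      congr 2
      ring
    · rw [add_mul, Complex.exp_add, hz₀, div_mul_cancel₀ _ hr', mul_comm (2 * (Real.pi : ℂ) * _),
        Complex.exp_int_mul_two_pi_mul_I, mul_one]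
  ext θ
  have h := hzero (r + θ) ⟨by linarith [θ.2.1], by linarith [θ.2.2]⟩
  rw [smul_eq_zero_iff_right (Complex.exp_ne_zero _), hper θ θ.2,
    smul_eq_zero_iff_right hm0] at h
  simpa using h

end Floquet

/-! ### Spectral gap and exponential decay of the transversal component -/

section Stability

/-- Gelfand's formula with `q` strictly between the spectral radius and `1`; the finitely many
exceptional powers go into `C`. -/
theorem exists_norm_pow_le_of_forall_spectrum_norm_lt_one {A : Type*} [NormedRing A]
    [NormedAlgebra ℂ A] [CompleteSpace A] (a : A) (ha : ∀ z ∈ spectrum ℂ a, ‖z‖ < 1) :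
    ∃ C q : ℝ, 0 ≤ C ∧ 0 < q ∧ q < 1 ∧ ∀ k : ℕ, ‖a ^ k‖ ≤ C * q ^ k := by
  rcases subsingleton_or_nontrivial A with hA | hA
  · exact ⟨0, 1 / 2, le_rfl, by norm_num, by norm_num, fun k => by simp [Subsingleton.elim (a ^ k) 0]⟩
  have hρ : spectralRadius ℂ a < (1 : ℝ≥0) :=
    spectrum.spectralRadius_lt_of_forall_lt a fun z hz => by
      rw [← NNReal.coe_lt_coe]; exact ha z hz
  obtain ⟨q, hq, hq1⟩ := ENNReal.lt_iff_exists_nnreal_btwn.1 hρ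
  have hq0 : 0 < q := by exact_mod_cast (zero_le : 0 ≤ spectralRadius ℂ a).trans_lt hq
  have hq0' : (0 : ℝ) < q := hq0
  have hev : ∀ᶠ n : ℕ in Filter.atTop, ‖a ^ n‖ / (q : ℝ) ^ n ≤ 1 := by
    filter_upwards [(spectrum.pow_nnnorm_pow_one_div_tendsto_nhds_spectralRadius a).eventually_lt_const
      hq, Filter.eventually_gt_atTop 0] with n hn hn0
    have hn0' : (0 : ℝ) < n := by exact_mod_cast hn0
    rw [one_div, ENNReal.rpow_inv_lt_iff hn0', ENNReal.rpow_natCast] at hn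
    rw [div_le_one (by positivity)]
    exact_mod_cast hn.le
  obtain ⟨C, hC⟩ := (Filter.isBoundedUnder_of_eventually_le hev).bddAbove_range
  refine ⟨C, q, ?_, hq0', by exact_mod_cast hq1, fun k => ?_⟩
  · exact (by positivity : (0 : ℝ) ≤ ‖a ^ 0‖ / (q : ℝ) ^ 0).trans (hC ⟨0, rfl⟩)
  · exact (div_le_iff₀ (by positivity)).1 (hC ⟨k, rfl⟩)

theorem exists_norm_pow_le_of_forall_eigenvector {E : Type*} [NormedAddCommGroup E]
    [NormedSpace ℂ E] [CompleteSpace E] {S : E →L[ℂ] E} (hS : IsCompactOperator S)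
    (h : ∀ (m : ℂ) (η : E), 1 ≤ ‖m‖ → S η = m • η → η = 0) :
    ∃ C q : ℝ, 0 ≤ C ∧ 0 < q ∧ q < 1 ∧ ∀ k : ℕ, ‖S ^ k‖ ≤ C * q ^ k := by
  refine exists_norm_pow_le_of_forall_spectrum_norm_lt_one S fun m hm => ?_
  by_contra! hm1
  have hm0 : m ≠ 0 := norm_pos_iff.1 (one_pos.trans_le hm1)
  obtain ⟨η, hη⟩ := ((hS.hasEigenvalue_iff_mem_spectrum hm0).2 hm).exists_hasEigenvector
  exact hη.2 (h m η hm1 hη.apply_eq_smul)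

theorem norm_le_of_norm_sub_apply_le {E : Type*} [NormedAddCommGroup E] [NormedSpace ℂ E]
    {S : E →L[ℂ] E} {C q B : ℝ} (hC : 0 ≤ C) (hq0 : 0 < q) (hq1 : q < 1)
    (hS : ∀ k : ℕ, ‖S ^ k‖ ≤ C * q ^ k) {η : ℕ → E} (hη : ∀ k, ‖η (k + 1) - S (η k)‖ ≤ B) (k : ℕ) :
    ‖η k‖ ≤ C * q ^ k * ‖η 0‖ + C * (1 - q)⁻¹ * B := by
  have hB : 0 ≤ B := (norm_nonneg _).trans (hη 0)
  -- Discrete variation of constants. Carrying `S ^ i` through the induction uses only the bounds on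
  -- powers; `‖S‖` itself may exceed one.
  have key : ∀ k i : ℕ, ‖(S ^ i) (η k)‖ ≤
      C * q ^ (i + k) * ‖η 0‖ + ∑ j ∈ Finset.range k, C * q ^ (i + j) * B := by
    intro k
    induction k with
    | zero =>
      intro i
      simpa using ((S ^ i).le_opNorm (η 0)).trans (by gcongr; exact hS i)
    | succ k ih =>
      intro i
      have h1 : (S ^ i) (η (k + 1)) = (S ^ (i + 1)) (η k) + (S ^ i) (η (k + 1) - S (η k)) := by
        rw [map_sub, pow_succ, mul_apply_eq_comp]
        abel
      have h2 : ‖(S ^ i) (η (k + 1) - S (η k))‖ ≤ C * q ^ i * B :=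
        ((S ^ i).le_opNorm _).trans (by gcongr; exacts [hS i, hη k])
      rw [h1, Finset.sum_range_succ', add_zero]
      refine (norm_add_le _ _).trans ((add_le_add (ih (i + 1)) h2).trans (le_of_eq ?_))
      have h3 : ∀ j, i + 1 + j = i + (j + 1) := fun j => by ring
      simp only [h3, add_assoc]
  have h := key k 0
  simp only [pow_zero, zero_add] at h
  refine h.trans ?_
  gcongr
  rw [← Finset.sum_mul, ← Finset.mul_sum]
  gcongr
  have hs := summable_geometric_of_lt_one hq0.le hq1
  rw [← tsum_geometric_of_lt_one hq0.le hq1]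
  exact hs.sum_le_tsum _ fun _ _ => by positivity

variable {V : Type*} [NormedAddCommGroup V] {r : ℝ}

/-- Time translation of a path. -/
def translate (x : C(ℝ, V)) (a : ℝ) : C(ℝ, V) := x.comp ⟨fun t => a + t, by fun_prop⟩

lemma history_translate (x : C(ℝ, V)) (a s : ℝ) :
    history r (translate x a) s = history r x (a + s) := by
  ext θ
  change x (a + (s + θ)) = x (a + s + θ)
  rw [add_assoc]

lemma intervalIntegrable_translate {f : ℝ → V} (hf : ∀ t, IntervalIntegrable f volume 0 t)
    (a t : ℝ) : IntervalIntegrable (fun s => f (a + s)) volume 0 t := by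
  have := ((hf a).symm.trans (hf (a + t))).comp_add_left a
  simpa using this

variable [NormedSpace ℂ V]

lemma SolvesOn.translate {L : C(Icc (-r) 0, V) →L[ℂ] V} {f : ℝ → V} {x : C(ℝ, V)} {a b : ℝ}
    (hx : SolvesOn L f (a + b) x) (hf : ∀ t, IntervalIntegrable f volume 0 t) (ha : 0 ≤ a) :
    SolvesOn L (fun t => f (a + t)) b (translate x a) := by
  intro t ht
  have hi : ∀ c, IntervalIntegrable (fun s => L (history r x s) + f s) volume 0 c := fun c =>
    ((continuous_comp_history L x).intervalIntegrable _ _).add (hf c)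
  simp only [history_translate]
  rw [intervalIntegral.integral_comp_add_left (fun s => L (history r x s) + f s) a, add_zero,
    ← intervalIntegral.integral_interval_sub_left (hi (a + t)) (hi a)]
  have h1 := hx (a + t) ⟨add_nonneg ha ht.1, by linarith [ht.2]⟩
  have h2 := hx a ⟨ha, by linarith [ht.1, ht.2]⟩
  change x (a + t) = x (a + 0) + _
  rw [add_zero, h1, h2]
  abel

/-- The projection along the constant segment `d`, with kernel spanned by `d`. -/
def stableProj (p : C(Icc (-r) 0, V) →L[ℂ] ℂ) (d : V) :
    C(Icc (-r) 0, V) →L[ℂ] C(Icc (-r) 0, V) :=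
  1 - p.smulRight (ContinuousMap.const _ d)

lemma stableProj_apply (p : C(Icc (-r) 0, V) →L[ℂ] ℂ) (d : V) (η : C(Icc (-r) 0, V)) :
    stableProj p d η = η - p η • ContinuousMap.const _ d := rfl

lemma stableProj_const {p : C(Icc (-r) 0, V) →L[ℂ] ℂ} {d : V}
    (hpd : p (ContinuousMap.const _ d) = 1) (c : ℂ) :
    stableProj p d (c • ContinuousMap.const _ d) = 0 := by
  rw [map_smul, stableProj_apply, hpd, one_smul, sub_self, smul_zero]

variable [FiniteDimensional ℂ V]

lemma solutionOp_const (hr : 0 ≤ r) {L : C(Icc (-r) 0, V) →L[ℂ] V} {d : V}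
    (hd : L (ContinuousMap.const _ d) = 0) :
    solutionOp hr L (ContinuousMap.const _ d) = ContinuousMap.const _ d := by
  have h : SolvesOn L 0 r (ContinuousMap.const ℝ d) := fun t _ => by
    have : ∀ s, history r (ContinuousMap.const ℝ d) s = ContinuousMap.const _ d := fun _ => rfl
    simp [this, hd]
  have h' := h.norm_history_sub_solutionOp_le hr (fun _ => intervalIntegrable_const) (M := 0)
    (by simp)
  rw [mul_zero, mul_zero] at h'
  exact (sub_eq_zero.1 (norm_le_zero_iff.1 h')).symm

lemma pairingCLM_solutionOp (hr : 0 ≤ r) {L : C(Icc (-r) 0, V) →L[ℂ] V} {l : V →L[ℂ] ℂ}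
    (hl : ∀ v, l (L (ContinuousMap.const _ v)) = 0) (η : C(Icc (-r) 0, V)) :
    pairingCLM hr L l (solutionOp hr L η) = pairingCLM hr L l η := by
  have : CompleteSpace V := FiniteDimensional.complete ℂ V
  have h := (solvesOn_flow hr L η).pairingCLM_history (fun _ => intervalIntegrable_const) hr hl
    ⟨hr, le_rfl⟩
  rw [history_flow_delay, history_flow_zero] at h
  simpa using h

/-- The projection lands in the kernel of the pairing, so `m ≠ 0` puts `η` there too. The solution
operator preserves the pairing, hence the projection acts trivially, `η` is a true eigenvector, and
its flow is a Floquet solution. -/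
theorem eq_zero_of_stableProj_solutionOp_eq_smul (hr : 0 < r) {L : C(Icc (-r) 0, V) →L[ℂ] V}
    {l : V →L[ℂ] ℂ} {d : V} (hl : ∀ v, l (L (ContinuousMap.const _ v)) = 0)
    (hpd : pairingCLM hr.le L l (ContinuousMap.const _ d) = 1)
    (hchar : ∀ (z : ℂ) (v : V), 0 ≤ z.re → z ≠ 0 → z • v = L (expSegment r z v) → v = 0)
    (hker : ∀ v, L (ContinuousMap.const _ v) = 0 →
      pairingCLM hr.le L l (ContinuousMap.const _ v) = 0 → v = 0) {m : ℂ} (hm : 1 ≤ ‖m‖)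
    {η : C(Icc (-r) 0, V)}
    (h1 : stableProj (pairingCLM hr.le L l) d (solutionOp hr.le L η) = m • η) : η = 0 := by
  have : CompleteSpace V := FiniteDimensional.complete ℂ V
  have hm0 : m ≠ 0 := norm_pos_iff.1 (one_pos.trans_le hm)
  set p := pairingCLM hr.le L l with hp
  rw [stableProj_apply, hp, pairingCLM_solutionOp hr.le hl, ← hp] at h1
  have h2 : p η = 0 := by
    have h := congrArg p h1
    rw [map_sub, map_smul, hpd, hp, pairingCLM_solutionOp hr.le hl, ← hp, smul_eq_mul, mul_one,
      sub_self, map_smul, smul_eq_mul] at h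
    exact (mul_eq_zero.1 h.symm).resolve_left hm0
  rw [h2, zero_smul, sub_zero] at h1
  have hflow := history_flow_zero hr.le L η
  rw [← hflow]
  refine (solvesOn_flow hr.le L η).history_eq_zero_of_floquet hr hm (fun θ hθ => ?_) hl hchar hker
    (by rw [hflow]; exact h2)
  have h3 := congrArg (fun ζ : C(Icc (-r) 0, V) => ζ ⟨θ, hθ⟩)
    ((history_flow_delay hr.le L η).trans (h1.trans (congrArg (m • ·) hflow.symm)))
  simpa using h3

/-- The solution operator fixes `d` and the projection kills it, so the transversal components at
times `r` apart obey a closed recursion up to the forcing. -/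
theorem norm_stableProj_history_sub_le (hr : 0 < r) {L : C(Icc (-r) 0, V) →L[ℂ] V}
    {p : C(Icc (-r) 0, V) →L[ℂ] ℂ} {d : V} (hd : L (ContinuousMap.const _ d) = 0)
    (hpd : p (ContinuousMap.const _ d) = 1) {x : C(ℝ, V)} {f : ℝ → V} {M : ℝ}
    (hx : ∀ b, SolvesOn L f b x) (hf : ∀ t, IntervalIntegrable f volume 0 t)
    (hM : ∀ t, 0 ≤ t → ‖f t‖ ≤ M) {a : ℝ} (ha : 0 ≤ a) :
    ‖stableProj p d (history r x (a + r)) -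
        (stableProj p d ∘L solutionOp hr.le L) (stableProj p d (history r x a))‖ ≤
      ‖stableProj p d‖ * (‖resolventCLM hr.le L‖ * (r * M)) := by
  have h := ((hx (a + r)).translate hf ha).norm_history_sub_solutionOp_le hr.le
    (intervalIntegrable_translate hf a) (fun s hs => hM (a + s) (add_nonneg ha hs.1))
  rw [history_translate, history_translate, add_zero] at h
  have h1 : (stableProj p d ∘L solutionOp hr.le L) (stableProj p d (history r x a)) =
      stableProj p d (solutionOp hr.le L (history r x a)) := by
    rw [ContinuousLinearMap.comp_apply, stableProj_apply p d (history r x a), map_sub, map_smul,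
      solutionOp_const hr.le hd, map_sub, stableProj_const hpd, sub_zero]
  rw [h1, ← map_sub]
  exact ((stableProj p d).le_opNorm _).trans
    (mul_le_mul_of_nonneg_left h (stableProj p d).opNorm_nonneg)

/-- Subtracting the stationary path `p (history r x a) • d` leaves a solution with the same forcing
that starts from the transversal component at `a`. The bound thus avoids the full history, whose
critical part need not decay. -/
theorem norm_stableProj_history_add_le (hr : 0 < r) {L : C(Icc (-r) 0, V) →L[ℂ] V}
    {p : C(Icc (-r) 0, V) →L[ℂ] ℂ} {d : V} (hd : L (ContinuousMap.const _ d) = 0)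
    (hpd : p (ContinuousMap.const _ d) = 1) {x : C(ℝ, V)} {f : ℝ → V} {M : ℝ}
    (hx : ∀ b, SolvesOn L f b x) (hf : ∀ t, IntervalIntegrable f volume 0 t)
    (hM : ∀ t, 0 ≤ t → ‖f t‖ ≤ M) {a s : ℝ} (ha : 0 ≤ a) (hs : s ∈ Icc 0 r) :
    ‖stableProj p d (history r x (a + s))‖ ≤
      ‖stableProj p d‖ * (‖resolventCLM hr.le L‖ * (‖stableProj p d (history r x a)‖ + r * M)) := by
  let y : C(ℝ, V) := translate x a - ContinuousMap.const ℝ (p (history r x a) • d)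
  have hyh : ∀ u, history r y u = history r x (a + u) -
      p (history r x a) • ContinuousMap.const _ d := fun u => by
    rw [← history_translate]
    rfl
  have hysol : SolvesOn L (fun s => f (a + s)) r y := fun u hu => by
    simp only [hyh, map_sub, map_smul, hd, smul_zero, sub_zero]
    have h := (hx (a + r)).translate hf ha u hu
    simp only [history_translate] at h
    change translate x a u - _ = translate x a 0 - _ + _
    rw [h]
    simp only [ContinuousMap.const_apply]
    abel
  have hyb := hysol.norm_history_le hr.le (intervalIntegrable_translate hf a)
    (fun s hs => hM (a + s) (add_nonneg ha hs.1)) hs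
  have hy0 : history r y 0 = stableProj p d (history r x a) := by
    rw [hyh, add_zero, stableProj_apply]
  have hproj : stableProj p d (history r x (a + s)) = stableProj p d (history r y s) := by
    rw [hyh, map_sub, stableProj_const hpd, sub_zero]
  rw [hproj, ← hy0]
  exact ((stableProj p d).le_opNorm _).trans
    (mul_le_mul_of_nonneg_left hyb (stableProj p d).opNorm_nonneg)

/-- The factor `q⁻¹` pays for rounding `t / r` down. -/
lemma pow_floor_le_inv_mul_exp {q r t : ℝ} (hq0 : 0 < q) (hq1 : q < 1) :
    q ^ ⌊t / r⌋₊ ≤ q⁻¹ * Real.exp (-(-Real.log q / r) * t) := by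
  have h1 : q ^ ⌊t / r⌋₊ = Real.exp (Real.log q * ⌊t / r⌋₊) := by
    rw [← Real.rpow_natCast, Real.rpow_def_of_pos hq0]
  have h2 : q⁻¹ = Real.exp (-Real.log q) := by rw [Real.exp_neg, Real.exp_log hq0]
  rw [h1, h2, ← Real.exp_add, Real.exp_le_exp]
  have h3 : t / r ≤ ⌊t / r⌋₊ + 1 := (Nat.lt_floor_add_one _).le
  have h4 : -(-Real.log q / r) * t = Real.log q * (t / r) := by ring
  rw [h4]
  nlinarith [Real.log_neg hq0 hq1]

/-- Exponential decay, up to the size of the forcing, of the component of a solution of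
`x' = L (history x) + f` transversal to the constant segment `d`. -/
theorem exists_norm_stableProj_history_le (hr : 0 < r) {L : C(Icc (-r) 0, V) →L[ℂ] V}
    {l : V →L[ℂ] ℂ} {d : V} (hl : ∀ v, l (L (ContinuousMap.const _ v)) = 0)
    (hd : L (ContinuousMap.const _ d) = 0)
    (hpd : pairingCLM hr.le L l (ContinuousMap.const _ d) = 1)
    (hchar : ∀ (z : ℂ) (v : V), 0 ≤ z.re → z ≠ 0 → z • v = L (expSegment r z v) → v = 0)
    (hker : ∀ v, L (ContinuousMap.const _ v) = 0 →
      pairingCLM hr.le L l (ContinuousMap.const _ v) = 0 → v = 0) :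
    ∃ A κ : ℝ, 0 ≤ A ∧ 0 < κ ∧ ∀ (x : C(ℝ, V)) (f : ℝ → V) (M : ℝ), (∀ b, SolvesOn L f b x) →
      (∀ t, IntervalIntegrable f volume 0 t) → (∀ t, 0 ≤ t → ‖f t‖ ≤ M) → ∀ t, 0 ≤ t →
      ‖stableProj (pairingCLM hr.le L l) d (history r x t)‖ ≤
        A * (Real.exp (-κ * t) * ‖history r x 0‖ + M) := by
  have : CompleteSpace V := FiniteDimensional.complete ℂ V
  obtain ⟨C, q, hC, hq0, hq1, hS⟩ := exists_norm_pow_le_of_forall_eigenvector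
    (S := stableProj (pairingCLM hr.le L l) d ∘L solutionOp hr.le L)
    ((isCompactOperator_solutionOp hr.le L).clm_comp (stableProj (pairingCLM hr.le L l) d))
    fun m η hm h => eq_zero_of_stableProj_solutionOp_eq_smul hr hl hpd hchar hker hm h
  generalize pairingCLM hr.le L l = p at hpd hS ⊢
  have hN0 : 0 ≤ ‖stableProj p d‖ := (stableProj p d).opNorm_nonneg
  have hQ0 : 0 ≤ ‖resolventCLM hr.le L‖ := (resolventCLM hr.le L).opNorm_nonneg
  have h1q : 0 < 1 - q := sub_pos.2 hq1
  have hkey : ∀ (x : C(ℝ, V)) (f : ℝ → V) (M : ℝ), (∀ b, SolvesOn L f b x) →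
      (∀ t, IntervalIntegrable f volume 0 t) → (∀ t, 0 ≤ t → ‖f t‖ ≤ M) → ∀ t, 0 ≤ t →
      ‖stableProj p d (history r x t)‖ ≤ ‖stableProj p d‖ * (‖resolventCLM hr.le L‖ *
        ((C * (q⁻¹ * Real.exp (-(-Real.log q / r) * t)) * (‖stableProj p d‖ * ‖history r x 0‖) +
          C * (1 - q)⁻¹ * (‖stableProj p d‖ * (‖resolventCLM hr.le L‖ * (r * M)))) + r * M)) := by
    intro x f M hx hf hM t ht
    have hstep : ∀ k : ℕ, ‖stableProj p d (history r x ((k + 1 : ℕ) * r)) -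
        (stableProj p d ∘L solutionOp hr.le L) (stableProj p d (history r x (k * r)))‖ ≤
        ‖stableProj p d‖ * (‖resolventCLM hr.le L‖ * (r * M)) := fun k => by
      have h := norm_stableProj_history_sub_le hr hd hpd hx hf hM (a := k * r) (by positivity)
      rwa [← add_one_mul, ← Nat.cast_add_one] at h
    have hηk := norm_le_of_norm_sub_apply_le hC hq0 hq1 hS
      (η := fun k : ℕ => stableProj p d (history r x (k * r))) hstep ⌊t / r⌋₊
    simp only [Nat.cast_zero, zero_mul] at hηk
    have hkt : ⌊t / r⌋₊ * r ≤ t := (le_div_iff₀ hr).1 (Nat.floor_le (by positivity))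
    have htk : t < (⌊t / r⌋₊ + 1) * r := (div_lt_iff₀ hr).1 (Nat.lt_floor_add_one _)
    have h := norm_stableProj_history_add_le hr hd hpd hx hf hM (a := ⌊t / r⌋₊ * r)
      (s := t - ⌊t / r⌋₊ * r) (by positivity) ⟨by linarith, by linarith⟩
    rw [add_sub_cancel] at h
    refine h.trans (mul_le_mul_of_nonneg_left (mul_le_mul_of_nonneg_left
      (add_le_add_left (hηk.trans (add_le_add_left ?_ _)) _) hQ0) hN0)
    exact mul_le_mul (mul_le_mul_of_nonneg_left (pow_floor_le_inv_mul_exp hq0 hq1) hC)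
      ((stableProj p d).le_opNorm _) (norm_nonneg _) (by positivity)
  generalize ‖stableProj p d‖ = N at hN0 hkey
  generalize ‖resolventCLM hr.le L‖ = Q at hQ0 hkey
  refine ⟨N * Q * (C * q⁻¹ * N) + N * Q * (C * (1 - q)⁻¹ * (N * (Q * r)) + r), -Real.log q / r,
    by positivity, div_pos (neg_pos.2 (Real.log_neg hq0 hq1)) hr, ?_⟩
  intro x f M hx hf hM t ht
  have hM0 : 0 ≤ M := (norm_nonneg _).trans (hM 0 le_rfl)
  refine (hkey x f M hx hf hM t ht).trans ?_
  have he : 0 ≤ Real.exp (-(-Real.log q / r) * t) := Real.exp_nonneg _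
  generalize Real.exp (-(-Real.log q / r) * t) = e at *
  have hX : 0 ≤ e * ‖history r x 0‖ := by positivity
  generalize ‖history r x 0‖ = X at *
  have h1 : 0 ≤ N * Q * (C * q⁻¹ * N) := by positivity
  have h2 : 0 ≤ N * Q * (C * (1 - q)⁻¹ * (N * (Q * r)) + r) := by positivity
  calc _ = N * Q * (C * q⁻¹ * N) * (e * X) +
        N * Q * (C * (1 - q)⁻¹ * (N * (Q * r)) + r) * M := by ring
    _ ≤ _ := by nlinarith [mul_nonneg h1 hM0, mul_nonneg h2 hX]

end Stability

/-! ### Order of vanishing of a determinant -/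

section Determinant

variable {ι : Type*} [Fintype ι] [DecidableEq ι]

lemma det_updateCol_mulVec (A : Matrix ι ι ℂ) (j : ι) (v : ι → ℂ) :
    (A.updateCol j (A *ᵥ v)).det = v j * A.det := by
  have h := Matrix.det_updateCol_sum A j v
  rw [smul_eq_mul] at h
  rw [← h]
  congr 2
  ext i
  simp [Matrix.mulVec, dotProduct, mul_comm]

/-- The determinant of a matrix family vanishes to second order where two independent vectors are
in the kernel. -/
theorem hasDerivAt_det_zero_of_mulVec_le {M : ℂ → Matrix ι ι ℂ} {d w : ι → ℂ} {i j : ι}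
    (hij : i ≠ j) (hdi : d i ≠ 0) (hwi : w i = 0) (hwj : w j ≠ 0) {B : ℝ}
    (hM : ∀ z, ‖z‖ ≤ 1 → ∀ a b, ‖M z a b‖ ≤ B)
    (hd : ∀ z, ‖z‖ ≤ 1 → ∀ a, ‖(M z *ᵥ d) a‖ ≤ B * ‖z‖)
    (hw : ∀ z, ‖z‖ ≤ 1 → ∀ a, ‖(M z *ᵥ w) a‖ ≤ B * ‖z‖) :
    HasDerivAt (fun z => (M z).det) 0 0 := by
  -- Columns `i` and `j` are replaced by the images of `d` and `w`; since `w i = 0`, the first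
  -- replacement does not disturb the image of `w`.
  have hdet : ∀ z, d i * w j * (M z).det =
      (((M z).updateCol i (M z *ᵥ d)).updateCol j (M z *ᵥ w)).det := fun z => by
    have h1 : M z *ᵥ w = ((M z).updateCol i (M z *ᵥ d)) *ᵥ w := by
      ext a
      refine Finset.sum_congr rfl fun b _ => ?_
      by_cases hb : b = i
      · subst hb; simp [hwi]
      · simp only [Matrix.updateCol_ne hb]
    rw [h1, det_updateCol_mulVec, det_updateCol_mulVec]
    ring
  have hbound : ∀ z, ‖z‖ ≤ 1 → ‖d i * w j * (M z).det‖ ≤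
      ((Fintype.card ι).factorial • B ^ Fintype.card ι) * ‖z‖ ^ 2 := by
    intro z hz
    by_cases hz0 : z = 0
    · subst hz0
      have h0 : M 0 *ᵥ d = 0 := funext fun a => by simpa using hd 0 (by simp) a
      have h1 : (M 0).det = 0 :=
        Matrix.exists_mulVec_eq_zero_iff.1 ⟨d, fun h => hdi (by simp [h]), h0⟩
      simp [h1]
    -- Both new columns are `O(z)`. Pulling one factor `z` out of each leaves entries bounded by
    -- `B`, so the determinant is `O(z²)`.
    have hsc : ∀ v : ι → ℂ, M z *ᵥ v = z • (z⁻¹ • (M z *ᵥ v)) := fun v => by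
      rw [smul_smul, mul_inv_cancel₀ hz0, one_smul]
    have hsb : ∀ v : ι → ℂ, (∀ a, ‖(M z *ᵥ v) a‖ ≤ B * ‖z‖) → ∀ a,
        ‖(z⁻¹ • (M z *ᵥ v)) a‖ ≤ B := fun v hv a => by
      rw [Pi.smul_apply, norm_smul, norm_inv, inv_mul_le_iff₀ (norm_pos_iff.2 hz0), mul_comm]
      exact hv a
    have hdb := hsb d (hd z hz)
    have hwb := hsb w (hw z hz)
    rw [hdet, hsc d, hsc w, Matrix.det_updateCol_smul, Matrix.updateCol_comm _ hij,
      Matrix.det_updateCol_smul, norm_mul, norm_mul]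
    generalize z⁻¹ • (M z *ᵥ d) = d' at *
    generalize z⁻¹ • (M z *ᵥ w) = w' at *
    let abv : AbsoluteValue ℂ ℝ :=
      ⟨⟨norm, norm_mul⟩, norm_nonneg, fun _ => norm_eq_zero, norm_add_le⟩
    have hle := Matrix.det_le (abv := abv)
      (A := ((M z).updateCol j w').updateCol i d') (x := B) fun a b => by
        change ‖((M z).updateCol j w').updateCol i d' a b‖ ≤ B
        rw [Matrix.updateCol_apply, Matrix.updateCol_apply]
        split_ifs
        exacts [hdb a, hwb a, hM z hz a b]
    change ‖(((M z).updateCol j w').updateCol i d').det‖ ≤ _ at hle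
    calc _ = ‖(((M z).updateCol j w').updateCol i d').det‖ * ‖z‖ ^ 2 := by ring
      _ ≤ _ := by gcongr
  have hO : (fun z => (M z).det) =O[nhds 0] fun z : ℂ => ‖z - 0‖ ^ 2 := by
    refine Asymptotics.IsBigO.of_bound
      (‖d i * w j‖⁻¹ * ((Fintype.card ι).factorial • B ^ Fintype.card ι)) ?_
    filter_upwards [Metric.closedBall_mem_nhds (0 : ℂ) one_pos] with z hz
    have hz' : ‖z‖ ≤ 1 := by simpa using hz
    have h := hbound z hz'
    rw [norm_mul] at h
    have hpos : 0 < ‖d i * w j‖ := norm_pos_iff.2 (mul_ne_zero hdi hwj)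
    rw [sub_zero, norm_pow, norm_norm, mul_assoc, le_inv_mul_iff₀ hpos]
    exact h
  have := (hO.hasFDerivAt one_lt_two).hasDerivAt
  simpa using this

end Determinant

/-! ### Stieltjes integrals and the characteristic matrix -/

namespace Kernel

variable {n : ℕ} {r : ℝ} (μ : Kernel n r)

/-- The signed Stieltjes measure of an entry of the kernel. -/
def entryMeasure (i j : Fin n) : SignedMeasure (Icc (-r) 0) :=
  (μ.boundedVariation i j).vectorMeasure

/-- The Jordan decomposition reduces linearity and norm bounds to Bochner integrals against finite
positive measures. -/
lemma stieltjes_eq_sub {E : Type*} [NormedAddCommGroup E] [NormedSpace ℝ E]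
    (i j : Fin n) (f : C(Icc (-r) 0, E)) : μ.stieltjes i j f =
      (∫ θ, f θ ∂(μ.entryMeasure i j).toJordanDecomposition.posPart) -
        ∫ θ, f θ ∂(μ.entryMeasure i j).toJordanDecomposition.negPart := by
  have hint : ∀ ν : Measure (Icc (-r) 0), IsFiniteMeasure ν → Integrable f ν := fun ν _ =>
    f.continuous.integrable_of_hasCompactSupport (HasCompactSupport.of_compactSpace f)
  have h := (μ.entryMeasure i j).toSignedMeasure_toJordanDecomposition
  rw [JordanDecomposition.toSignedMeasure] at h
  change (μ.entryMeasure i j).integral f _ = _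
  conv_lhs => rw [← h]
  rw [VectorMeasure.integral_sub_vectorMeasure]
  · simp
  · simpa [VectorMeasure.Integrable] using hint _ inferInstance
  · simpa [VectorMeasure.Integrable] using hint _ inferInstance

lemma integrable_segment {E : Type*} [NormedAddCommGroup E] (f : C(Icc (-r) 0, E))
    (ν : Measure (Icc (-r) 0)) [IsFiniteMeasure ν] : Integrable f ν :=
  f.continuous.integrable_of_hasCompactSupport (HasCompactSupport.of_compactSpace f)

lemma stieltjes_ofReal (i j : Fin n) (f : C(Icc (-r) 0, ℝ)) :
    μ.stieltjes i j (fun θ => (f θ : ℂ)) = ((μ.stieltjes i j f : ℝ) : ℂ) := by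
  have h := μ.stieltjes_eq_sub i j (⟨fun θ => (f θ : ℂ), by fun_prop⟩ : C(Icc (-r) 0, ℂ))
  simp only [ContinuousMap.coe_mk] at h
  rw [h, stieltjes_eq_sub, integral_complex_ofReal, integral_complex_ofReal, Complex.ofReal_sub]

/-- The Stieltjes integral against an entry of the kernel as a bounded functional. -/
def stieltjesCLM (i j : Fin n) : C(Icc (-r) 0, ℂ) →L[ℂ] ℂ :=
  LinearMap.mkContinuous
    { toFun := fun f => μ.stieltjes i j f
      map_add' := fun f g => by
        simp only [stieltjes_eq_sub, ContinuousMap.add_apply]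
        rw [integral_add (integrable_segment f _) (integrable_segment g _),
          integral_add (integrable_segment f _) (integrable_segment g _)]
        ring
      map_smul' := fun c f => by
        simp only [stieltjes_eq_sub, ContinuousMap.smul_apply, integral_smul, smul_sub,
          RingHom.id_apply] }
    ((μ.entryMeasure i j).toJordanDecomposition.posPart.real univ +
      (μ.entryMeasure i j).toJordanDecomposition.negPart.real univ) fun f => by
    change ‖μ.stieltjes i j f‖ ≤ _
    have h : ∀ (ν : Measure (Icc (-r) 0)) [IsFiniteMeasure ν],
        ‖∫ θ, f θ ∂ν‖ ≤ ν.real univ * ‖f‖ := fun ν _ => by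
      rw [mul_comm]
      exact norm_integral_le_of_norm_le_const (Filter.Eventually.of_forall f.norm_coe_le_norm)
    rw [stieltjes_eq_sub, add_mul]
    exact (norm_sub_le _ _).trans (add_le_add (h _) (h _))

lemma stieltjesCLM_apply (i j : Fin n) (f : C(Icc (-r) 0, ℂ)) :
    μ.stieltjesCLM i j f = μ.stieltjes i j f := rfl

/-- The coordinates of a vector-valued segment. -/
def coordSegment (n : ℕ) (r : ℝ) (j : Fin n) :
    C(Icc (-r) 0, Fin n → ℂ) →L[ℂ] C(Icc (-r) 0, ℂ) :=
  (ContinuousLinearMap.proj j : (Fin n → ℂ) →L[ℂ] ℂ).compLeftContinuous ℂ (Icc (-r) 0)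

/-- The complexification of `L₀`. -/
def complexL₀ : C(Icc (-r) 0, Fin n → ℂ) →L[ℂ] (Fin n → ℂ) :=
  ContinuousLinearMap.pi fun i => ∑ j, μ.stieltjesCLM i j ∘L coordSegment n r j

lemma complexL₀_apply (η : C(Icc (-r) 0, Fin n → ℂ)) (i : Fin n) :
    μ.complexL₀ η i = ∑ j, μ.stieltjes i j fun θ => η θ j := by
  simp [complexL₀, stieltjesCLM_apply]
  rfl

/-- This turns null vectors of `Δ(z)` into exponential solutions, the form in which the Floquet
argument meets the characteristic equation. -/
lemma charMatrix_mulVec (z : ℂ) (v : Fin n → ℂ) :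
    μ.charMatrix z *ᵥ v = z • v - μ.complexL₀ (expSegment r z v) := by
  rw [charMatrix, Matrix.sub_mulVec, Matrix.smul_mulVec, Matrix.one_mulVec]
  congr 1
  ext i
  rw [complexL₀_apply]
  simp only [Matrix.mulVec, dotProduct, Matrix.of_apply]
  refine Finset.sum_congr rfl fun j _ => ?_
  let f : C(Icc (-r) 0, ℂ) := ⟨fun θ => Complex.exp (z * ((θ : ℝ) : ℂ)), by fun_prop⟩
  have h := (μ.stieltjesCLM i j).map_smul (v j) f
  rw [smul_eq_mul, mul_comm] at h
  refine h.symm.trans ?_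
  rw [stieltjesCLM_apply]
  congr 1
  funext θ
  exact mul_comm _ _

lemma complexL₀_const (v : Fin n → ℂ) :
    μ.complexL₀ (ContinuousMap.const _ v) = -(μ.charMatrix 0 *ᵥ v) := by
  rw [charMatrix_mulVec, expSegment_zero, zero_smul, zero_sub, neg_neg]

lemma eq_zero_of_smul_eq_complexL₀ (hμ : μ.IsOnVergeOfInstability) {z : ℂ} {v : Fin n → ℂ}
    (hz : 0 ≤ z.re) (hz0 : z ≠ 0) (h : z • v = μ.complexL₀ (expSegment r z v)) : v = 0 := by
  by_contra hv
  have h0 : (μ.charMatrix z).det = 0 :=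
    Matrix.exists_mulVec_eq_zero_iff.1 ⟨v, hv, by rw [charMatrix_mulVec, h, sub_self]⟩
  exact absurd (hμ.2.2 z h0 hz0) (not_lt.2 hz)

lemma norm_expSegment_sub_le (hr : 0 ≤ r) {z : ℂ} (hz : ‖z‖ ≤ 1) (v : Fin n → ℂ) :
    ‖expSegment r z v - ContinuousMap.const _ v‖ ≤ r * Real.exp r * ‖v‖ * ‖z‖ := by
  refine (ContinuousMap.norm_le _ (by positivity)).2 fun θ => ?_
  have hθ : |(θ : ℝ)| ≤ r := abs_le.2 ⟨θ.2.1, θ.2.2.trans hr⟩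
  rw [ContinuousMap.sub_apply, expSegment_apply, ContinuousMap.const_apply]
  have h1 : Complex.exp (z * (θ : ℝ)) • v - v = (Complex.exp (z * (θ : ℝ)) - 1) • v := by
    rw [sub_smul, one_smul]
  have h2 : ‖z * ((θ : ℝ) : ℂ)‖ ≤ ‖z‖ * r := by
    rw [norm_mul, Complex.norm_real]
    gcongr
    exact hθ
  have h3 : ‖Complex.exp (z * (θ : ℝ)) - 1‖ ≤ ‖z‖ * r * Real.exp r := by
    have h := Complex.norm_exp_sub_sum_le_norm_mul_exp (z * (θ : ℝ)) 1
    simp only [Finset.range_one, Finset.sum_singleton, pow_zero, Nat.factorial_zero,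
      Nat.cast_one, div_one, pow_one] at h
    refine h.trans ?_
    gcongr
    exact h2.trans (mul_le_of_le_one_left hr hz)
  rw [h1, norm_smul]
  calc _ ≤ ‖z‖ * r * Real.exp r * ‖v‖ := by gcongr
    _ = _ := by ring

lemma norm_charMatrix_mulVec_sub_le {z : ℂ} (hz : ‖z‖ ≤ 1) (v : Fin n → ℂ) :
    ‖μ.charMatrix z *ᵥ v - μ.charMatrix 0 *ᵥ v‖ ≤
      (1 + ‖μ.complexL₀‖ * (r * Real.exp r)) * ‖v‖ * ‖z‖ := by
  have h : μ.charMatrix z *ᵥ v - μ.charMatrix 0 *ᵥ v =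
      z • v - μ.complexL₀ (expSegment r z v - ContinuousMap.const _ v) := by
    rw [charMatrix_mulVec, charMatrix_mulVec, expSegment_zero, zero_smul, map_sub]
    abel
  rw [h]
  refine (norm_sub_le _ _).trans ?_
  have h1 := (μ.complexL₀.le_opNorm _).trans (mul_le_mul_of_nonneg_left
    (norm_expSegment_sub_le μ.pos.le hz v) μ.complexL₀.opNorm_nonneg)
  rw [norm_smul]
  calc _ ≤ ‖z‖ * ‖v‖ + ‖μ.complexL₀‖ * (r * Real.exp r * ‖v‖ * ‖z‖) := by gcongr
    _ = _ := by ring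

/-- The kernel of `Δ(0)` is at most one-dimensional if `0` is a simple characteristic root. -/
theorem exists_eq_smul_of_charMatrix_mulVec_eq_zero (hμ : μ.IsOnVergeOfInstability)
    {d v : Fin n → ℂ} (hd0 : d ≠ 0) (hd : μ.charMatrix 0 *ᵥ d = 0)
    (hv : μ.charMatrix 0 *ᵥ v = 0) : ∃ c : ℂ, v = c • d := by
  obtain ⟨i, hi⟩ := Function.ne_iff.1 hd0
  refine ⟨v i / d i, ?_⟩
  by_contra hne
  -- A second null vector, with its `i`-th entry cleared as `hasDerivAt_det_zero_of_mulVec_le`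
  -- requires; it would force the derivative of the determinant at `0` to vanish.
  set w := v - (v i / d i) • d with hw
  have hw0 : w ≠ 0 := sub_ne_zero.2 hne
  have hwi : w i = 0 := by
    simp only [hw, Pi.sub_apply, Pi.smul_apply, smul_eq_mul]
    rw [div_mul_cancel₀ _ hi, sub_self]
  have hwk : μ.charMatrix 0 *ᵥ w = 0 := by
    rw [hw, Matrix.mulVec_sub, Matrix.mulVec_smul, hd, hv, smul_zero, sub_zero]
  obtain ⟨j, hj⟩ := Function.ne_iff.1 hw0
  have hij : i ≠ j := fun h => hj (h ▸ hwi)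
  set c := 1 + ‖μ.complexL₀‖ * (r * Real.exp r) with hc
  have hr := μ.pos
  have hL0 := μ.complexL₀.opNorm_nonneg
  have hc0 : 0 ≤ c := by positivity
  set B := c * ‖d‖ + c * ‖w‖ + (c + ∑ a, ∑ b, ‖μ.charMatrix 0 a b‖) with hB
  have hsum : 0 ≤ ∑ a, ∑ b, ‖μ.charMatrix 0 a b‖ := by positivity
  have hvec : ∀ u : Fin n → ℂ, μ.charMatrix 0 *ᵥ u = 0 → c * ‖u‖ ≤ B → ∀ z : ℂ, ‖z‖ ≤ 1 →
      ∀ a, ‖(μ.charMatrix z *ᵥ u) a‖ ≤ B * ‖z‖ := fun u hu huB z hz a => by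
    have h := μ.norm_charMatrix_mulVec_sub_le hz u
    rw [hu, sub_zero] at h
    exact (norm_le_pi_norm _ a).trans (h.trans (by gcongr))
  refine hμ.2.1 (hasDerivAt_det_zero_of_mulVec_le hij hi hwi hj (B := B) ?_
    (hvec d hd ?_) (hvec w hwk ?_)).deriv
  · intro z hz a b
    have h := (norm_le_pi_norm _ a).trans (μ.norm_charMatrix_mulVec_sub_le hz (Pi.single b 1))
    rw [Matrix.mulVec_single_one, Matrix.mulVec_single_one, Pi.norm_single, norm_one,
      mul_one, Pi.sub_apply] at h
    have h1 : ‖μ.charMatrix z a b‖ ≤ ‖μ.charMatrix z a b - μ.charMatrix 0 a b‖ +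
        ‖μ.charMatrix 0 a b‖ := by
      simpa using norm_add_le (μ.charMatrix z a b - μ.charMatrix 0 a b) (μ.charMatrix 0 a b)
    have h2 : ‖μ.charMatrix 0 a b‖ ≤ ∑ a, ∑ b, ‖μ.charMatrix 0 a b‖ :=
      (Finset.single_le_sum (f := fun b => ‖μ.charMatrix 0 a b‖) (fun _ _ => norm_nonneg _)
        (Finset.mem_univ b)).trans
        (Finset.single_le_sum (f := fun a => ∑ b, ‖μ.charMatrix 0 a b‖)
          (fun _ _ => by positivity) (Finset.mem_univ a))
    have h3 : c * ‖z‖ ≤ c := mul_le_of_le_one_right hc0 hz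
    have h4 : 0 ≤ c * ‖d‖ + c * ‖w‖ := by positivity
    calc _ ≤ c * ‖z‖ + ‖μ.charMatrix 0 a b‖ := h1.trans (by gcongr; exact h)
      _ ≤ B := by linarith
  · have : 0 ≤ c * ‖w‖ := by positivity
    linarith
  · have : 0 ≤ c * ‖d‖ := by positivity
    linarith

end Kernel

/-! ### Transfer between real and complex segments -/

section Complexification

/-- The inclusion of `ℝⁿ` into `ℂⁿ`. -/
def complexifyCLM (n : ℕ) : EuclideanSpace ℝ (Fin n) →L[ℝ] (Fin n → ℂ) :=
  ContinuousLinearMap.pi fun i => Complex.ofRealCLM ∘L EuclideanSpace.proj i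

@[simp] lemma complexifyCLM_apply {n : ℕ} (v : EuclideanSpace ℝ (Fin n)) (i : Fin n) :
    complexifyCLM n v i = (v i : ℂ) := rfl

lemma exists_antilipschitzWith_complexifyCLM (n : ℕ) :
    ∃ K, AntilipschitzWith K (complexifyCLM n) := by
  obtain ⟨K, -, hK⟩ := (complexifyCLM n).toLinearMap.exists_antilipschitzWith (by
    rw [LinearMap.ker_eq_bot]
    intro v w h
    ext i
    have := congrFun h i
    exact Complex.ofReal_injective this)
  exact ⟨K, hK⟩

variable {n : ℕ} {r : ℝ}

/-- The complexification of a segment. -/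
def complexifySegment (η : Segment n r) : C(Icc (-r) 0, Fin n → ℂ) :=
  ⟨fun θ => complexifyCLM n (η θ), by fun_prop⟩

@[simp] lemma complexifySegment_apply (η : Segment n r) (θ : Icc (-r) 0) :
    complexifySegment η θ = complexifyCLM n (η θ) := rfl

lemma norm_complexifySegment_le (η : Segment n r) :
    ‖complexifySegment η‖ ≤ ‖complexifyCLM n‖ * ‖η‖ :=
  (ContinuousMap.norm_le _ (mul_nonneg (complexifyCLM n).opNorm_nonneg (norm_nonneg _))).2
    fun θ => ((complexifyCLM n).le_opNorm _).trans
      (mul_le_mul_of_nonneg_left (η.norm_coe_le_norm θ) (complexifyCLM n).opNorm_nonneg)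

lemma norm_le_complexifySegment {K : ℝ≥0} (hK : AntilipschitzWith K (complexifyCLM n))
    (η : Segment n r) : ‖η‖ ≤ K * ‖complexifySegment η‖ := by
  refine (ContinuousMap.norm_le _ (by positivity)).2 fun θ => ?_
  have h := hK.le_mul_dist (η θ) 0
  rw [map_zero, dist_zero_right, dist_zero_right] at h
  exact h.trans (by gcongr; exact (complexifySegment η).norm_coe_le_norm θ)

/-- The extension of a path on `[-r, ∞)` to the line, complexified. -/
def complexifyPath (x : C(Ici (-r), EuclideanSpace ℝ (Fin n))) : C(ℝ, Fin n → ℂ) :=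
  ⟨fun t => complexifyCLM n (x (projIci (-r) t)), by
    refine (complexifyCLM n).continuous.comp (x.continuous.comp ?_)
    exact Continuous.subtype_mk (by fun_prop) _⟩

lemma history_complexifyPath (x : C(Ici (-r), EuclideanSpace ℝ (Fin n))) (t : ℝ) :
    history r (complexifyPath x) t = complexifySegment (segment x t) := rfl

lemma continuous_segment (x : C(Ici (-r), EuclideanSpace ℝ (Fin n))) : Continuous (segment x) := by
  have hc : Continuous fun t => x (projIci (-r) t) :=
    x.continuous.comp (Continuous.subtype_mk (by fun_prop) _)
  exact continuous_history (r := r) (⟨_, hc⟩ : C(ℝ, EuclideanSpace ℝ (Fin n)))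

/-- The row vector `ψ` as a functional on `ℂⁿ`. -/
def rowCLM (ψ : Fin n → ℝ) : (Fin n → ℂ) →L[ℂ] ℂ :=
  ∑ i, (ψ i : ℂ) • ContinuousLinearMap.proj i

lemma rowCLM_apply (ψ : Fin n → ℝ) (v : Fin n → ℂ) : rowCLM ψ v = ∑ i, (ψ i : ℂ) * v i := by
  simp [rowCLM]

namespace Kernel

variable (μ : Kernel n r)

lemma complexL₀_complexifySegment (η : Segment n r) :
    μ.complexL₀ (complexifySegment η) = complexifyCLM n (μ.L₀ η) := by
  ext i
  rw [complexL₀_apply, complexifyCLM_apply, L₀, PiLp.toLp_apply, Complex.ofReal_sum]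
  refine Finset.sum_congr rfl fun j _ => ?_
  exact μ.stieltjes_ofReal i j ⟨fun θ => η θ j, by fun_prop⟩

lemma stieltjes_const_mul (i j : Fin n) (a : ℝ) (f : C(Icc (-r) 0, ℝ)) :
    μ.stieltjes i j (fun θ => a * f θ) = a * μ.stieltjes i j f := by
  have h := μ.stieltjes_eq_sub i j (⟨fun θ => a * f θ, by fun_prop⟩ : C(Icc (-r) 0, ℝ))
  simp only [ContinuousMap.coe_mk] at h
  rw [h, stieltjes_eq_sub, integral_const_mul, integral_const_mul, mul_sub]

/-- A constant row leaves the inner integral, so the double integral becomes `ψ` applied to `L₀` of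
the primitive of `η`. -/
lemma pairing_const (ψ : Fin n → ℝ) (η : Segment n r) :
    (μ.pairing (ContinuousMap.const _ ψ) η : ℂ) =
      pairingCLM μ.pos.le μ.complexL₀ (rowCLM ψ) (complexifySegment η) := by
  have hint : ∀ j a b, IntervalIntegrable
      (fun s => η (projIcc (-r) 0 (neg_nonpos.2 μ.pos.le) s) j) volume a b := fun j a b => by
    have h : Continuous fun s => η (projIcc (-r) 0 (neg_nonpos.2 μ.pos.le) s) :=
      η.continuous.comp continuous_projIcc
    exact Continuous.intervalIntegrable (by fun_prop) _ _
  have hprim : ∀ j, ∃ g : C(Icc (-r) 0, ℝ), ∀ θ, g θ =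
      ∫ s in (0 : ℝ)..θ, η (projIcc (-r) 0 (neg_nonpos.2 μ.pos.le) s) j := fun j =>
    ⟨⟨_, (intervalIntegral.continuous_primitive (hint j) 0).comp continuous_subtype_val⟩,
      fun _ => rfl⟩
  choose g hg using hprim
  have hcoord : ∀ j θ, primitiveCLM (Fin n → ℂ) μ.pos.le (complexifySegment η) θ j = (g j θ : ℂ) :=
    fun j θ => by
    rw [primitiveCLM_apply, hg, ← intervalIntegral.integral_ofReal]
    have hi := intervalIntegrable_projIcc μ.pos.le (complexifySegment η) 0 θ
    exact ((ContinuousLinearMap.proj j : (Fin n → ℂ) →L[ℂ] ℂ).intervalIntegral_comp_comm hi).symm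
  rw [pairingCLM_apply, rowCLM_apply, rowCLM_apply, pairing, Complex.ofReal_sub,
    projIcc_of_mem (neg_nonpos.2 μ.pos.le) ⟨neg_nonpos.2 μ.pos.le, le_rfl⟩]
  simp only [ContinuousMap.const_apply, Complex.ofReal_sum, Complex.ofReal_mul,
    complexifySegment_apply, complexifyCLM_apply, intervalIntegral.integral_const_mul]
  congr 1
  refine Finset.sum_congr rfl fun i _ => ?_
  rw [complexL₀_apply, Finset.mul_sum]
  refine Finset.sum_congr rfl fun j _ => ?_
  simp only [hcoord, ← hg]
  rw [stieltjes_const_mul, stieltjes_ofReal, Complex.ofReal_mul]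

lemma continuous_pairing_segment (ψ : Fin n → ℝ) (x : C(Ici (-r), EuclideanSpace ℝ (Fin n))) :
    Continuous fun t => μ.pairing (ContinuousMap.const _ ψ) (segment x t) := by
  have h : ∀ t, μ.pairing (ContinuousMap.const _ ψ) (segment x t) =
      (pairingCLM μ.pos.le μ.complexL₀ (rowCLM ψ) (history r (complexifyPath x) t)).re := fun t => by
    rw [history_complexifyPath, ← pairing_const, Complex.ofReal_re]
  simp only [h]
  exact Complex.continuous_re.comp
    ((ContinuousLinearMap.continuous _).comp (continuous_history _))

/-- For the forced linear equation, the component `⟨Ψ, Π_t x⟩` only moves with the forcing, and the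
transversal component decays exponentially up to the size of the forcing. -/
theorem exists_norm_segment_sub_pairing_smul_le (hμ : μ.IsOnVergeOfInstability)
    {d : EuclideanSpace ℝ (Fin n)} {ψ : Fin n → ℝ}
    (hd : μ.charMatrix 0 *ᵥ (fun i => (d i : ℂ)) = 0)
    (hψ : (fun i => (ψ i : ℂ)) ᵥ* μ.charMatrix 0 = 0)
    (hψd : μ.pairing (ContinuousMap.const _ ψ) (ContinuousMap.const _ d) = 1) :
    ∃ A κ : ℝ, 0 ≤ A ∧ 0 < κ ∧
      ∀ (x : C(Ici (-r), EuclideanSpace ℝ (Fin n))) (f : ℝ → EuclideanSpace ℝ (Fin n)) (M : ℝ),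
      (∀ t, IntervalIntegrable f volume 0 t) → (∀ t, 0 ≤ t → ‖f t‖ ≤ M) →
      (∀ t, 0 ≤ t → x (projIci (-r) t) = x (projIci (-r) 0) +
        ∫ s in (0 : ℝ)..t, (μ.L₀ (segment x s) + f s)) → ∀ t, 0 ≤ t →
      μ.pairing (ContinuousMap.const _ ψ) (segment x t) =
          μ.pairing (ContinuousMap.const _ ψ) (segment x 0) +
            ∫ s in (0 : ℝ)..t, ∑ i, ψ i * f s i ∧
        ‖segment x t - μ.pairing (ContinuousMap.const _ ψ) (segment x t) •
          (ContinuousMap.const _ d : Segment n r)‖ ≤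
            A * (Real.exp (-κ * t) * ‖segment x 0‖ + M) := by
  obtain ⟨K, hK⟩ := exists_antilipschitzWith_complexifyCLM n
  have hdc : complexifySegment (ContinuousMap.const _ d : Segment n r) =
      ContinuousMap.const _ (complexifyCLM n d) := rfl
  have hψ' : ∀ v, rowCLM ψ v = (fun i => (ψ i : ℂ)) ⬝ᵥ v := rowCLM_apply ψ
  have hl : ∀ v, rowCLM ψ (μ.complexL₀ (ContinuousMap.const _ v)) = 0 := fun v => by
    rw [complexL₀_const, map_neg, hψ', Matrix.dotProduct_mulVec, hψ, zero_dotProduct, neg_zero]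
  have hd' : μ.complexL₀ (ContinuousMap.const _ (complexifyCLM n d)) = 0 := by
    rw [complexL₀_const]
    exact neg_eq_zero.2 hd
  have hpd : pairingCLM μ.pos.le μ.complexL₀ (rowCLM ψ)
      (ContinuousMap.const _ (complexifyCLM n d)) = 1 := by
    rw [← hdc, ← pairing_const, hψd, Complex.ofReal_one]
  have hd0 : complexifyCLM n d ≠ 0 := fun h => by
    rw [h] at hpd
    have h0 : (ContinuousMap.const (Icc (-r) 0) (0 : Fin n → ℂ)) = 0 := rfl
    rw [h0, map_zero] at hpd
    exact zero_ne_one hpd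
  have hker : ∀ v, μ.complexL₀ (ContinuousMap.const _ v) = 0 →
      pairingCLM μ.pos.le μ.complexL₀ (rowCLM ψ) (ContinuousMap.const _ v) = 0 → v = 0 := by
    intro v hv hpv
    rw [complexL₀_const, neg_eq_zero] at hv
    obtain ⟨a, rfl⟩ := μ.exists_eq_smul_of_charMatrix_mulVec_eq_zero hμ hd0 hd hv
    have h1 : ContinuousMap.const (Icc (-r) 0) (a • complexifyCLM n d) =
        a • ContinuousMap.const _ (complexifyCLM n d) := rfl
    rw [h1, map_smul, hpd, smul_eq_mul, mul_one] at hpv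
    rw [hpv, zero_smul]
  obtain ⟨A, κ, hA, hκ, hstab⟩ := exists_norm_stableProj_history_le μ.pos hl hd' hpd
    (fun z v hz hz0 h => μ.eq_zero_of_smul_eq_complexL₀ hμ hz hz0 h) hker
  set N := ‖complexifyCLM n‖ with hN
  have hN0 : 0 ≤ N := (complexifyCLM n).opNorm_nonneg
  refine ⟨K * A * N, κ, by positivity, hκ, fun x f M hf hM hx t ht => ?_⟩
  have hsol : ∀ b, SolvesOn μ.complexL₀ (fun s => complexifyCLM n (f s)) b (complexifyPath x) := by
    intro b t ht
    change complexifyCLM n (x (projIci (-r) t)) = complexifyCLM n (x (projIci (-r) 0)) + _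
    -- The antilipschitz bound lets the inclusion commute with the integral without any
    -- integrability check.
    rw [hx t ht.1, map_add, intervalIntegral.integral_of_le ht.1,
      intervalIntegral.integral_of_le ht.1, ← (complexifyCLM n).integral_comp_comm' hK]
    simp only [map_add, history_complexifyPath, complexL₀_complexifySegment]
  have hfc : ∀ t, IntervalIntegrable (fun s => complexifyCLM n (f s)) volume 0 t := fun t =>
    ⟨(complexifyCLM n).integrable_comp (hf t).1, (complexifyCLM n).integrable_comp (hf t).2⟩
  have hz : ∀ s, pairingCLM μ.pos.le μ.complexL₀ (rowCLM ψ) (history r (complexifyPath x) s) =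
      (μ.pairing (ContinuousMap.const _ ψ) (segment x s) : ℂ) := fun s => by
    rw [history_complexifyPath, pairing_const]
  constructor
  · have h := (hsol t).pairingCLM_history hfc μ.pos.le hl ⟨ht, le_rfl⟩
    rw [hz, hz] at h
    have h1 : ∀ s, rowCLM ψ (complexifyCLM n (f s)) = ((∑ i, ψ i * f s i : ℝ) : ℂ) := fun s => by
      simp [rowCLM_apply]
    simp only [h1, intervalIntegral.integral_ofReal] at h
    exact_mod_cast h
  · have h := hstab _ _ (N * M) hsol hfc (fun t ht => ((complexifyCLM n).le_opNorm _).trans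
      (mul_le_mul_of_nonneg_left (hM t ht) hN0)) t ht
    have h1 : stableProj (pairingCLM μ.pos.le μ.complexL₀ (rowCLM ψ)) (complexifyCLM n d)
        (history r (complexifyPath x) t) = complexifySegment (segment x t -
          μ.pairing (ContinuousMap.const _ ψ) (segment x t) •
            (ContinuousMap.const _ d : Segment n r)) := by
      rw [stableProj_apply, hz, history_complexifyPath]
      ext θ i
      simp
    rw [h1, history_complexifyPath] at h
    refine (norm_le_complexifySegment hK _).trans ?_
    calc _ ≤ K * (A * (Real.exp (-κ * t) * (N * ‖segment x 0‖) + N * M)) := by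
          gcongr
          exact h.trans (by gcongr; exact norm_complexifySegment_le _)
      _ = _ := by ring

end Kernel

end Complexification

/-! ### Gronwall comparison with the reduced equation -/

section Averaging

/-- The differential Gronwall inequality is applied to the majorant `a + b ∫ v`, which is
differentiable although `v` is only continuous. -/
theorem le_mul_exp_of_le_add_integral {v : ℝ → ℝ} (hv : Continuous v) (h0 : ∀ t, 0 ≤ v t)
    {a b τ : ℝ} (hb : 0 ≤ b) (h : ∀ t ∈ Icc 0 τ, v t ≤ a + b * ∫ s in (0 : ℝ)..t, v s)
    {t : ℝ} (ht : t ∈ Icc 0 τ) : v t ≤ a * Real.exp (b * t) := by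
  have ha : 0 ≤ a := by
    have := h 0 ⟨le_rfl, ht.1.trans ht.2⟩
    rw [intervalIntegral.integral_same, mul_zero, add_zero] at this
    exact (h0 0).trans this
  have hderiv : ∀ s, HasDerivAt (fun s => a + b * ∫ q in (0 : ℝ)..s, v q) (b * v s) s := fun s =>
    ((intervalIntegral.integral_hasDerivAt_right (hv.intervalIntegrable _ _)
      (hv.stronglyMeasurableAtFilter _ _) hv.continuousAt).const_mul b).const_add a
  have hg := norm_le_gronwallBound_of_norm_deriv_right_le (δ := a) (K := b) (ε := 0) (a := 0)
    (b := τ) (fun s _ => (hderiv s).continuousAt.continuousWithinAt)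
    (fun s _ => (hderiv s).hasDerivWithinAt) (by simp [abs_of_nonneg ha])
    (fun s hs => by
      have h1 := h s ⟨hs.1, hs.2.le⟩
      rw [norm_mul, Real.norm_of_nonneg hb, Real.norm_of_nonneg (h0 s), add_zero]
      gcongr
      exact h1.trans (le_abs_self _)) t ht
  rw [gronwallBound_ε0, sub_zero] at hg
  exact (h t ht).trans ((le_abs_self _).trans hg)

lemma integral_exp_neg_mul_le {κ : ℝ} (hκ : 0 < κ) (t : ℝ) :
    ∫ s in (0 : ℝ)..t, Real.exp (-κ * s) ≤ κ⁻¹ := by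
  rw [intervalIntegral.integral_comp_mul_left (fun s => Real.exp s) (neg_ne_zero.2 hκ.ne'),
    integral_exp, smul_eq_mul, mul_zero, Real.exp_zero, inv_neg]
  have h1 : 0 ≤ κ⁻¹ := by positivity
  nlinarith [mul_nonneg h1 (Real.exp_nonneg (-κ * t))]

variable {n : ℕ} {r : ℝ}

/-- The perturbation `ε G(η) + ε F(η) a`. -/
def forcing (G F : Segment n r → EuclideanSpace ℝ (Fin n)) (ε a : ℝ) (η : Segment n r) :
    EuclideanSpace ℝ (Fin n) := ε • G η + (ε * a) • F η

lemma norm_forcing_le {G F : Segment n r → EuclideanSpace ℝ (Fin n)} {MG MF Mu : ℝ}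
    (hG : ∀ η, ‖G η‖ ≤ MG) (hF : ∀ η, ‖F η‖ ≤ MF) {ε a : ℝ} (hε : 0 ≤ ε) (ha : |a| ≤ Mu)
    (η : Segment n r) : ‖forcing G F ε a η‖ ≤ (MG + Mu * MF) * ε := by
  have hMu : 0 ≤ Mu := (abs_nonneg a).trans ha
  refine (norm_add_le _ _).trans ?_
  rw [norm_smul, norm_smul, norm_mul, Real.norm_of_nonneg hε, Real.norm_eq_abs]
  calc _ ≤ ε * MG + ε * Mu * MF := by gcongr; exacts [hG η, hF η]
    _ = _ := by ring

lemma norm_forcing_sub_le {G F : Segment n r → EuclideanSpace ℝ (Fin n)} {KG KF Mu : ℝ}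
    (hG : ∀ η ζ, ‖G η - G ζ‖ ≤ KG * ‖η - ζ‖) (hF : ∀ η ζ, ‖F η - F ζ‖ ≤ KF * ‖η - ζ‖) {ε a : ℝ}
    (hε : 0 ≤ ε) (ha : |a| ≤ Mu) (η ζ : Segment n r) :
    ‖forcing G F ε a η - forcing G F ε a ζ‖ ≤ (KG + Mu * KF) * ε * ‖η - ζ‖ := by
  have hMu : 0 ≤ Mu := (abs_nonneg a).trans ha
  have h : forcing G F ε a η - forcing G F ε a ζ =
      ε • (G η - G ζ) + (ε * a) • (F η - F ζ) := by
    simp only [forcing, smul_sub]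
    abel
  rw [h]
  refine (norm_add_le _ _).trans ?_
  rw [norm_smul, norm_smul, norm_mul, Real.norm_of_nonneg hε, Real.norm_eq_abs]
  calc _ ≤ ε * (KG * ‖η - ζ‖) + ε * Mu * (KF * ‖η - ζ‖) := by gcongr; exacts [hG η ζ, hF η ζ]
    _ = _ := by ring

lemma intervalIntegrable_forcing {G F : Segment n r → EuclideanSpace ℝ (Fin n)} {MG MF Mu : ℝ}
    (hGc : Continuous G) (hFc : Continuous F)
    (hG : ∀ η, ‖G η‖ ≤ MG) (hF : ∀ η, ‖F η‖ ≤ MF) {ε : ℝ} (hε : 0 ≤ ε) {u : ℝ → ℝ}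
    (hu : Measurable u) (hub : ∀ t, |u t| ≤ Mu) {γ : ℝ → Segment n r} (hγ : Continuous γ)
    (a b : ℝ) : IntervalIntegrable (fun s => forcing G F ε (u s) (γ s)) volume a b := by
  have hmeas : AEStronglyMeasurable (fun s => forcing G F ε (u s) (γ s)) volume :=
    ((hGc.comp hγ).aestronglyMeasurable.const_smul ε).add
      ((hu.const_mul ε).aestronglyMeasurable.smul (hFc.comp hγ).aestronglyMeasurable)
  have hc : IntervalIntegrable (fun _ : ℝ => (MG + Mu * MF) * ε) volume a b :=
    intervalIntegrable_const
  refine hc.mono_fun hmeas.restrict (Filter.Eventually.of_forall fun s => ?_)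
  exact (norm_forcing_le hG hF hε (hub s) (γ s)).trans (le_abs_self _)

lemma BoundedWithBoundedDeriv.exists_bounds {G : Segment n r → EuclideanSpace ℝ (Fin n)}
    (hG : BoundedWithBoundedDeriv G) : Continuous G ∧ ∃ M K : ℝ, 0 ≤ M ∧ 0 ≤ K ∧
      (∀ η, ‖G η‖ ≤ M) ∧ ∀ η ζ, ‖G η - G ζ‖ ≤ K * ‖η - ζ‖ := by
  obtain ⟨⟨M, hM⟩, hd, K, hK⟩ := hG
  exact ⟨hd.continuous, M, K, (norm_nonneg _).trans (hM 0),
    (ContinuousLinearMap.opNorm_nonneg _).trans (hK 0), hM, fun η ζ =>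
      convex_univ.norm_image_sub_le_of_norm_fderiv_le (𝕜 := ℝ) (fun ξ _ => hd ξ) (fun ξ _ => hK ξ)
        (mem_univ ζ) (mem_univ η)⟩

lemma abs_sum_mul_le (ψ : Fin n → ℝ) (v : EuclideanSpace ℝ (Fin n)) :
    |∑ i, ψ i * v i| ≤ (∑ i, |ψ i|) * ‖v‖ := by
  rw [Finset.sum_mul]
  refine (Finset.abs_sum_le_sum_abs _ _).trans (Finset.sum_le_sum fun i _ => ?_)
  rw [abs_mul]
  gcongr
  exact PiLp.norm_apply_le v i

lemma intervalIntegrable_sum_mul {f : ℝ → EuclideanSpace ℝ (Fin n)} {a b : ℝ}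
    (hf : IntervalIntegrable f volume a b) (ψ : Fin n → ℝ) :
    IntervalIntegrable (fun s => ∑ i, ψ i * f s i) volume a b := by
  have h : ∀ i, IntervalIntegrable (fun s => f s i) volume a b := fun i =>
    ⟨(EuclideanSpace.proj i : EuclideanSpace ℝ (Fin n) →L[ℝ] ℝ).integrable_comp hf.1,
      (EuclideanSpace.proj i : EuclideanSpace ℝ (Fin n) →L[ℝ] ℝ).integrable_comp hf.2⟩
  have h' := IntervalIntegrable.sum Finset.univ fun i _ => (h i).const_mul (ψ i)
  simpa only [Finset.sum_fn] using h'

/-- Comparison of two scalar paths driven by a Lipschitz forcing along nearby segments. -/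
theorem abs_sub_le_of_integral_eq {G F : Segment n r → EuclideanSpace ℝ (Fin n)}
    {MG MF KG KF Mu : ℝ} (hGc : Continuous G) (hFc : Continuous F)
    (hMG : ∀ η, ‖G η‖ ≤ MG) (hMF : ∀ η, ‖F η‖ ≤ MF) (hKG0 : 0 ≤ KG) (hKF0 : 0 ≤ KF)
    (hKG : ∀ η ζ, ‖G η - G ζ‖ ≤ KG * ‖η - ζ‖) (hKF : ∀ η ζ, ‖F η - F ζ‖ ≤ KF * ‖η - ζ‖)
    {ε : ℝ} (hε : 0 < ε) {u : ℝ → ℝ} (hu : Measurable u) (hub : ∀ t, |u t| ≤ Mu)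
    {ψ : Fin n → ℝ} {Φ : Segment n r} {γ : ℝ → Segment n r} (hγ : Continuous γ) {z w : ℝ → ℝ}
    (hzc : Continuous z) (hwc : ContinuousOn w (Ici 0))
    (hz : ∀ t, 0 ≤ t → z t = z 0 + ∫ s in (0 : ℝ)..t, ∑ i, ψ i * forcing G F ε (u s) (γ s) i)
    (hw : ∀ t, 0 ≤ t → w t = z 0 + ∫ s in (0 : ℝ)..t, ∑ i, ψ i * forcing G F ε (u s) (w s • Φ) i)
    {A κ R M T : ℝ} (hA : 0 ≤ A) (hκ : 0 < κ) (hR : 0 ≤ R) (hM : 0 ≤ M)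
    (hγz : ∀ t, 0 ≤ t → ‖γ t - z t • Φ‖ ≤ A * (Real.exp (-κ * t) * R + M * ε))
    {t : ℝ} (ht : t ∈ Icc 0 (T / ε)) :
    |z t - w t| ≤ (∑ i, |ψ i|) * (KG + Mu * KF) * (A * (R * κ⁻¹ + M * T)) *
      Real.exp ((∑ i, |ψ i|) * (KG + Mu * KF) * ‖Φ‖ * T) * ε := by
  have hMu : 0 ≤ Mu := (abs_nonneg _).trans (hub 0)
  set K := (∑ i, |ψ i|) * (KG + Mu * KF) with hK
  have hsum : 0 ≤ ∑ i, |ψ i| := by positivity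
  have hK0 : 0 ≤ K := by positivity
  -- Nothing is known of `w` at negative times; freezing it there gives a path continuous on the
  -- line.
  set w' : ℝ → ℝ := fun t => w (max t 0) with hw'
  have hw'c : Continuous w' := hwc.comp_continuous (by fun_prop) fun t => le_max_right t 0
  have hw'w : ∀ t, 0 ≤ t → w' t = w t := fun t ht => by rw [hw']; simp only [max_eq_left ht]
  set v : ℝ → ℝ := fun t => |z t - w' t| with hv
  have hvc : Continuous v := (hzc.sub hw'c).abs
  have hint1 : ∀ t, IntervalIntegrable (fun s => ∑ i, ψ i * forcing G F ε (u s) (γ s) i)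
      volume 0 t := fun t =>
    intervalIntegrable_sum_mul
      (intervalIntegrable_forcing hGc hFc hMG hMF hε.le hu hub hγ 0 t) ψ
  have hint2 : ∀ t, IntervalIntegrable (fun s => ∑ i, ψ i * forcing G F ε (u s) (w' s • Φ) i)
      volume 0 t := fun t =>
    intervalIntegrable_sum_mul
      (intervalIntegrable_forcing hGc hFc hMG hMF hε.le hu hub (by fun_prop) 0 t) ψ
  have hdiff : ∀ t, 0 ≤ t → z t - w' t = ∫ s in (0 : ℝ)..t,
      ((∑ i, ψ i * forcing G F ε (u s) (γ s) i) -
        ∑ i, ψ i * forcing G F ε (u s) (w' s • Φ) i) := fun t ht => by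
    rw [intervalIntegral.integral_sub (hint1 t) (hint2 t), hw'w t ht, hz t ht, hw t ht,
      add_sub_add_left_eq_sub]
    congr 1
    refine intervalIntegral.integral_congr fun s hs => ?_
    rw [uIcc_of_le ht] at hs
    simp only [hw'w s hs.1]
  have hbound : ∀ s, 0 ≤ s → |(∑ i, ψ i * forcing G F ε (u s) (γ s) i) -
      ∑ i, ψ i * forcing G F ε (u s) (w' s • Φ) i| ≤
        K * ε * (A * R) * Real.exp (-κ * s) + K * ε * (A * (M * ε)) + K * ε * ‖Φ‖ * v s := by
    intro s hs
    have h1 : (∑ i, ψ i * forcing G F ε (u s) (γ s) i) -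
        ∑ i, ψ i * forcing G F ε (u s) (w' s • Φ) i =
        ∑ i, ψ i * (forcing G F ε (u s) (γ s) - forcing G F ε (u s) (w' s • Φ)) i := by
      rw [← Finset.sum_sub_distrib]
      refine Finset.sum_congr rfl fun i _ => ?_
      rw [PiLp.sub_apply, mul_sub]
    have h2 : ‖γ s - w' s • Φ‖ ≤ A * (Real.exp (-κ * s) * R + M * ε) + v s * ‖Φ‖ := by
      have h3 : γ s - w' s • Φ = (γ s - z s • Φ) + (z s - w' s) • Φ := by
        ext θ i
        simp [sub_mul]
      rw [h3]
      refine (norm_add_le _ _).trans (add_le_add (hγz s hs) ?_)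
      rw [norm_smul, Real.norm_eq_abs]
    rw [h1]
    calc _ ≤ (∑ i, |ψ i|) * ((KG + Mu * KF) * ε *
          (A * (Real.exp (-κ * s) * R + M * ε) + v s * ‖Φ‖)) := by
          refine (abs_sum_mul_le ψ _).trans ?_
          gcongr
          refine (norm_forcing_sub_le hKG hKF hε.le (hub s) _ _).trans ?_
          gcongr
      _ = _ := by rw [hK]; ring
  have hexpc : Continuous fun s : ℝ => K * ε * (A * R) * Real.exp (-κ * s) := by fun_prop
  have hgron : ∀ t ∈ Icc 0 (T / ε), v t ≤ K * (A * (R * κ⁻¹ + M * T)) * ε +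
      K * ε * ‖Φ‖ * ∫ s in (0 : ℝ)..t, v s := by
    intro t ht
    have htT : t * ε ≤ T := (le_div_iff₀ hε).1 ht.2
    have hvi : IntervalIntegrable (fun s => K * ε * ‖Φ‖ * v s) volume 0 t :=
      Continuous.intervalIntegrable (by fun_prop) _ _
    have hei : IntervalIntegrable (fun s : ℝ => K * ε * (A * R) * Real.exp (-κ * s)) volume 0 t :=
      hexpc.intervalIntegrable _ _
    have hci : IntervalIntegrable (fun _ : ℝ => K * ε * (A * (M * ε))) volume 0 t :=
      intervalIntegrable_const
    have h := intervalIntegral.norm_integral_le_of_norm_le ht.1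
      (f := fun s => (∑ i, ψ i * forcing G F ε (u s) (γ s) i) -
        ∑ i, ψ i * forcing G F ε (u s) (w' s • Φ) i)
      (Filter.Eventually.of_forall fun s (hs : s ∈ Ioc 0 t) => hbound s hs.1.le)
      ((hei.add hci).add hvi)
    rw [← hdiff t ht.1, intervalIntegral.integral_add (hei.add hci) hvi,
      intervalIntegral.integral_add hei hci, intervalIntegral.integral_const, sub_zero,
      smul_eq_mul, intervalIntegral.integral_const_mul, intervalIntegral.integral_const_mul] at h
    refine h.trans (add_le_add_left ?_ _)
    -- The transient integrates to at most `κ⁻¹` uniformly in `t`, and the remaining `O(ε²)` term is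
    -- absorbed by `t * ε ≤ T`; both leave one factor `ε`.
    have h1 := mul_le_mul_of_nonneg_left (integral_exp_neg_mul_le hκ t)
      (by positivity : 0 ≤ K * ε * (A * R))
    have h2 := mul_le_mul_of_nonneg_left htT (by positivity : 0 ≤ K * ε * (A * M))
    calc _ ≤ K * ε * (A * R) * κ⁻¹ + K * ε * (A * M) * T :=
          add_le_add h1 (le_trans (le_of_eq (by ring)) h2)
      _ = _ := by ring
  have hfin := le_mul_exp_of_le_add_integral hvc (fun _ => abs_nonneg _)
    (by positivity : 0 ≤ K * ε * ‖Φ‖) hgron ht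
  have htT : t * ε ≤ T := (le_div_iff₀ hε).1 ht.2
  have hT : 0 ≤ T := (mul_nonneg ht.1 hε.le).trans htT
  rw [← hw'w t ht.1]
  calc |z t - w' t| ≤ K * (A * (R * κ⁻¹ + M * T)) * ε * Real.exp (K * ε * ‖Φ‖ * t) := hfin
    _ ≤ K * (A * (R * κ⁻¹ + M * T)) * ε * Real.exp (K * ‖Φ‖ * T) := by
        have h1 : K * ε * ‖Φ‖ * t ≤ K * ‖Φ‖ * T := by
          calc K * ε * ‖Φ‖ * t = K * ‖Φ‖ * (t * ε) := by ring
            _ ≤ K * ‖Φ‖ * T := by gcongr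
        exact mul_le_mul_of_nonneg_left (Real.exp_le_exp.2 h1) (by positivity)
    _ = _ := by ring

end Averaging

end DelayEq

end

/-! ### The uniform error estimate -/

theorem mainTheorem2 {n : ℕ} {r : ℝ} (μ : DelayEq.Kernel n r)
    (hμ : μ.IsOnVergeOfInstability)
    (d : EuclideanSpace ℝ (Fin n)) (d₂ : Fin n → ℝ) (c : ℝ)
    (hd : μ.charMatrix 0 *ᵥ (fun i => (d i : ℂ)) = 0)
    (hd₂ : (fun i => (d₂ i : ℂ)) ᵥ* μ.charMatrix 0 = 0)
    (Φ : DelayEq.Segment n r) (hΦ : Φ = ContinuousMap.const _ d)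
    (Ψ : DelayEq.RowSegment n r) (hΨ : Ψ = ContinuousMap.const _ (c • d₂))
    (hΨΦ : μ.pairing Ψ Φ = 1)
    (G F : DelayEq.Segment n r → EuclideanSpace ℝ (Fin n))
    (hG : DelayEq.BoundedWithBoundedDeriv G) (hF : DelayEq.BoundedWithBoundedDeriv F)
    {Ω S : Type*} (ξ : ℝ≥0 → Ω → S) (σ : S → ℝ)
    (hσ : ∃ M : ℝ, ∀ a, |σ a| ≤ M)
    (T : ℝ) (hT : 0 < T) (R : ℝ) :
    ∃ C : ℝ, 0 < C ∧ ∀ ε : ℝ, 0 < ε →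
      ∀ ω : Ω, Measurable (fun t : ℝ≥0 => σ (ξ t ω)) →
      ∀ η : DelayEq.Segment n r, ‖η‖ ≤ R →
      ∀ x : C(Set.Ici (-r), EuclideanSpace ℝ (Fin n)),
        DelayEq.IsSolution μ G F ε (fun s => σ (ξ s.toNNReal ω)) η x →
      ∀ w : ℝ → ℝ,
        DelayEq.IsReducedSolution (c • d₂) Φ G F ε (fun s => σ (ξ s.toNNReal ω))
          (μ.pairing Ψ (DelayEq.segment x 0)) w →
      ∀ t ∈ Set.Icc 0 (T / ε), |μ.pairing Ψ (DelayEq.segment x t) - w t| ≤ C * ε := by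
  subst hΦ hΨ
  obtain ⟨hGc, MG, KG, hMG0, hKG0, hMG, hKG⟩ := hG.exists_bounds
  obtain ⟨hFc, MF, KF, hMF0, hKF0, hMF, hKF⟩ := hF.exists_bounds
  obtain ⟨Mσ, hMσ⟩ := hσ
  have hψ : (fun i => ((c • d₂) i : ℂ)) ᵥ* μ.charMatrix 0 = 0 := by
    have h : (fun i => ((c • d₂) i : ℂ)) = (c : ℂ) • fun i => (d₂ i : ℂ) := by
      ext i
      simp
    rw [h, Matrix.smul_vecMul, hd₂, smul_zero]
  obtain ⟨A, κ, hA, hκ, hstab⟩ := μ.exists_norm_segment_sub_pairing_smul_le hμ hd hψ hΨΦ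
  -- Neither `R` nor `Mσ` is known to be nonnegative, hence the absolute values. `B` may be zero, so
  -- `B + 1` serves as the positive constant.
  set B := (∑ i, |(c • d₂) i|) * (KG + |Mσ| * KF) * (A * (|R| * κ⁻¹ + (MG + |Mσ| * MF) * T)) *
    Real.exp ((∑ i, |(c • d₂) i|) * (KG + |Mσ| * KF) *
      ‖(ContinuousMap.const _ d : DelayEq.Segment n r)‖ * T) with hB
  have hB0 : 0 ≤ B := by positivity
  refine ⟨B + 1, by positivity, fun ε hε ω hmeas η hη x hx w hw t ht => ?_⟩
  have hu : Measurable fun s : ℝ => σ (ξ s.toNNReal ω) := hmeas.comp measurable_real_toNNReal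
  have hub : ∀ s : ℝ, |σ (ξ s.toNNReal ω)| ≤ |Mσ| := fun s => (hMσ _).trans (le_abs_self _)
  have hγ := DelayEq.continuous_segment x
  have hlin := hstab x
    (fun s => DelayEq.forcing G F ε (σ (ξ s.toNNReal ω)) (DelayEq.segment x s))
    ((MG + |Mσ| * MF) * ε)
    (DelayEq.intervalIntegrable_forcing hGc hFc hMG hMF hε.le hu hub hγ 0)
    (fun s _ => DelayEq.norm_forcing_le hMG hMF hε.le (hub s) _)
    (fun s hs => by simpa only [DelayEq.forcing, add_assoc] using hx.2 s hs)
  have hη' : ‖DelayEq.segment x 0‖ ≤ |R| := by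
    rw [hx.1]
    exact hη.trans (le_abs_self _)
  have h := DelayEq.abs_sub_le_of_integral_eq hGc hFc hMG hMF hKG0 hKF0 hKG hKF hε hu hub hγ
    (μ.continuous_pairing_segment (c • d₂) x) hw.1 (fun s hs => (hlin s hs).1)
    (fun s hs => by
      rw [hw.2 s hs]
      congr 1
      refine intervalIntegral.integral_congr fun q _ => ?_
      simp only [DelayEq.forcing, PiLp.add_apply, PiLp.smul_apply, smul_eq_mul, mul_add,
        Finset.sum_add_distrib, Finset.mul_sum, Finset.sum_mul]
      congr 1 <;> exact Finset.sum_congr rfl fun i _ => by ring)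
    hA hκ (abs_nonneg R) (by positivity : 0 ≤ MG + |Mσ| * MF)
    (fun s hs => (hlin s hs).2.trans (by gcongr)) ht
  exact h.trans (by gcongr; linarith)
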